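/- Let $k$ be a field of characteristic zero. Let $(H,R,\alpha,\beta,\Delta,\epsilon)$ be a bialgebroid over $k$: $H$ and $R$ are unital associative $k$-algebras, $\alpha:R\to H$ is an algebra homomorphism, $\beta:R\to H$ is an anti-algebra homomorphism, $\alpha(a)\beta(b)=\beta(b)\alpha(a)$ for all $a,b\in R$, and $H$ is an $R$-bimodule by $a\cdot x\cdot b=\alpha(a)\beta(b)x$. The coproduct $\Delta:H\to H\otimes_R H$, written $\Delta(h)=h^{(1)}\otimes_R h^{(2)}$, is a coassociative $R$-bimodule map with $\Delta(1)=1\otimes_R 1$, $\Delta(h)(\beta(r)\otimes 1-1\otimes\alpha(r))=0$ and $\Delta(hg)=\Delta(h)\Delta(g)$ for all $h,g\in H$, $r\in R$. The counit $\epsilon:H\to R$ is an $R$-bimodule map with $\epsilon(1_H)=1_R$ and $(\epsilon\otimes_R \mathrm{id})\Delta=(\mathrm{id}\otimes_R\epsilon)\Delta=\mathrm{id}_H$. Suppose that $H$ is a para-Hopf algebroid, i.e. it is equipped with a (unital, $k$-linear) anti-algebra map $T:H\to H$ such that $T\beta=\alpha$, $m_H(T\otimes\mathrm{id})\Delta=\beta\epsilon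 T$ (where $m_H$ is the multiplication of $H$), $T^2=\mathrm{id}_H$, and $$T(h^{(1)})^{(1)}h^{(2)}\otimes_R T(h^{(1)})^{(2)}=1\otimes_R T(h)\qquad(h\in H).$$ Put $H_\natural^0=R$ and $H_\natural^n=H\otimes_R\cdots\otimes_R H$ ($n$ factors) for $n\ge1$. Let $\delta_0=\alpha$, $\delta_1=\beta$ on $H^0_\natural$, and for $n\ge 1$ let $\delta_0(x)=1\otimes_R x$, $\delta_{n+1}(x)=x\otimes_R 1$, and let $\delta_i$ $(1\le i\le n)$ apply $\Delta$ to the $i$-th factor. Let $b=\sum_{i=0}^{n+1}(-1)^i\delta_i:H_\natural^n\to H_\natural^{n+1}$. Let $\tau_0=\mathrm{id}$ and, for $n\ge1$, $\tau_n(h_1\otimes_R\cdots\otimes_R h_n)=\Delta^{n-1}(T(h_1))\cdot(h_2\otimes\cdots\otimes h_n\otimes 1_H)$. The cyclic cohomology $HC^n(H)$ is the $n$-th cohomology of the complex of cyclic cochains $\{x\in H_\natural^n:\tau_n x=(-1)^n x\}$ with differential $b$. Suppose that $H$ admits a normal left Haar system, i.e. a right $R$-module map $t:H\to R$ (so $t(\beta(r)h)=t(h)r$)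 such that $\alpha(t(h^{(1)}))h^{(2)}=\alpha(t(h))1_H$ and $\alpha(t(h))=\beta(t(h))$ for all $h\in H$, and $t(1_H)=1_R$. Then for all $i\ge 0$, $HC^{2i+1}(H)=0$ and $HC^{2i}(H)\cong\ker(\alpha-\beta:R\to H)$ as $k$-vector spaces. -/

import Mathlib

open scoped TensorProduct

universe u v

namespace ParaHopf

/-! ## Left modules over the base algebra -/

/-- A left module over the `k`-algebra `R`, given as a `k`-vector space together with an algebra
homomorphism from `R` to its `k`-linear endomorphisms. -/
structure LMod (k : Type v) (R : Type u) [Field k] [Ring R] [Algebra k R] where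
  carrier : Type u
  [addCommGroup : AddCommGroup carrier]
  [module : Module k carrier]
  act : R →ₐ[k] Module.End k carrier

attribute [instance] LMod.addCommGroup LMod.module

/-- Homomorphisms of left `R`-modules. -/
structure LMod.Hom {k : Type v} {R : Type u} [Field k] [Ring R] [Algebra k R]
    (M N : LMod k R) where
  toLin : M.carrier →ₗ[k] N.carrier
  map_act : ∀ (r : R) (m : M.carrier), toLin (M.act r m) = N.act r (toLin m)

/-- The base algebra as a left module over itself. -/
abbrev LMod.base (k : Type v) (R : Type u) [Field k] [Ring R] [Algebra k R] : LMod k R where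
  carrier := R
  act := Algebra.lmul k R

/-! ## Source and target maps, and tensor products over the base -/

/-- A total algebra `H` over a base algebra `R`: an algebra homomorphism `α : R → H` (source) and
an anti-algebra homomorphism `β : R → H` (target) whose images commute.
The bimodule structure on `H` is `a · x · b = α a * β b * x`. -/
structure SourceTarget (k : Type v) (R H : Type u) [Field k] [Ring R] [Algebra k R]
    [Ring H] [Algebra k H] where
  α : R →ₐ[k] H
  β : R →ₗ[k] H
  β_one : β 1 = 1
  β_mul : ∀ a b : R, β (a * b) = β b * β a
  comm : ∀ a b : R, α a * β b = β b * α a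

namespace SourceTarget

variable {k : Type v} {R H : Type u} [Field k] [Ring R] [Algebra k R] [Ring H] [Algebra k H]
variable (S : SourceTarget k R H)

/-- `H` as a left `R`-module through left multiplication by `α`. -/
abbrev self : LMod k R where
  carrier := H
  act := (Algebra.lmul k H).comp S.α

/-- The relations `h · r ⊗ m = h ⊗ r · m`, where `h · r = β r * h`. -/
def rel (M : LMod k R) : Submodule k (H ⊗[k] M.carrier) :=
  Submodule.span k {t | ∃ (r : R) (h : H) (m : M.carrier),
    t = (S.β r * h) ⊗ₜ[k] m - h ⊗ₜ[k] (M.act r m)}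

/-- The vector space `H ⊗_R M`. -/
abbrev Tens (M : LMod k R) : Type u := (H ⊗[k] M.carrier) ⧸ S.rel M

/-- The canonical projection `H ⊗_k M → H ⊗_R M`. -/
def proj (M : LMod k R) : H ⊗[k] M.carrier →ₗ[k] S.Tens M := (S.rel M).mkQ

theorem proj_surjective (M : LMod k R) : Function.Surjective (S.proj M) :=
  (S.rel M).mkQ_surjective

/-- The element `h ⊗_R m`. -/
def tmul (M : LMod k R) (h : H) (m : M.carrier) : S.Tens M := S.proj M (h ⊗ₜ[k] m)

theorem tmul_balanced (M : LMod k R) (r : R) (h : H) (m : M.carrier) :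
    S.tmul M (S.β r * h) m = S.tmul M h (M.act r m) := by
  refine (Submodule.Quotient.eq _).2 (Submodule.subset_span ⟨r, h, m, rfl⟩)

/-- A bilinear map `f` with `f (h · r) m = f h (r · m)` induces a map on `H ⊗_R M`. -/
def lift {P : Type u} [AddCommGroup P] [Module k P] (M : LMod k R)
    (f : H →ₗ[k] M.carrier →ₗ[k] P)
    (hf : ∀ (r : R) (h : H) (m : M.carrier), f (S.β r * h) m = f h (M.act r m)) :
    S.Tens M →ₗ[k] P :=
  (S.rel M).liftQ (TensorProduct.lift f) (by
    refine Submodule.span_le.2 ?_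
    rintro _ ⟨r, h, m, rfl⟩
    simp [hf])

theorem lift_proj {P : Type u} [AddCommGroup P] [Module k P] (M : LMod k R)
    (f : H →ₗ[k] M.carrier →ₗ[k] P)
    (hf : ∀ (r : R) (h : H) (m : M.carrier), f (S.β r * h) m = f h (M.act r m))
    (t : H ⊗[k] M.carrier) : S.lift M f hf (S.proj M t) = TensorProduct.lift f t := rfl

@[simp] theorem lift_tmul {P : Type u} [AddCommGroup P] [Module k P] (M : LMod k R)
    (f : H →ₗ[k] M.carrier →ₗ[k] P)
    (hf : ∀ (r : R) (h : H) (m : M.carrier), f (S.β r * h) m = f h (M.act r m))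
    (h : H) (m : M.carrier) : S.lift M f hf (S.tmul M h m) = f h m := rfl

theorem hom_ext {P : Type u} [AddCommGroup P] [Module k P] {M : LMod k R}
    {f g : S.Tens M →ₗ[k] P} (hfg : ∀ h m, f (S.tmul M h m) = g (S.tmul M h m)) : f = g := by
  refine Submodule.linearMap_qext _ (TensorProduct.ext' fun h m => hfg h m)

/-- The bilinear map `(h, m) ↦ h ⊗_R m`. -/
def tmulBilin (M : LMod k R) : H →ₗ[k] M.carrier →ₗ[k] S.Tens M :=
  (TensorProduct.mk k H M.carrier).compr₂ (S.proj M)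

@[simp] theorem tmulBilin_apply (M : LMod k R) (h : H) (m : M.carrier) :
    S.tmulBilin M h m = S.tmul M h m := rfl

theorem add_tmul (M : LMod k R) (a b : H) (m : M.carrier) :
    S.tmul M (a + b) m = S.tmul M a m + S.tmul M b m := (S.tmulBilin M).map_add₂ a b m

theorem tmul_add (M : LMod k R) (a : H) (m n : M.carrier) :
    S.tmul M a (m + n) = S.tmul M a m + S.tmul M a n := (S.tmulBilin M a).map_add m n

theorem smul_tmul (M : LMod k R) (c : k) (a : H) (m : M.carrier) :
    S.tmul M (c • a) m = c • S.tmul M a m := (S.tmulBilin M).map_smul₂ c a m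

theorem tmul_smul (M : LMod k R) (c : k) (a : H) (m : M.carrier) :
    S.tmul M a (c • m) = c • S.tmul M a m := (S.tmulBilin M a).map_smul c m

theorem zero_tmul (M : LMod k R) (m : M.carrier) :
    S.tmul M 0 m = 0 := (S.tmulBilin M).map_zero₂ m

/-- `f ⊗_R g` for a right `R`-linear map `f : H → H` and a left `R`-linear map `g : M → N`. -/
def map {M N : LMod k R} (f : H →ₗ[k] H) (hf : ∀ (r : R) (h : H), f (S.β r * h) = S.β r * f h)
    (g : M.Hom N) : S.Tens M →ₗ[k] S.Tens N :=
  S.lift M ((S.tmulBilin N).compl₁₂ f g.toLin) (fun r h m => by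
    simp [hf, g.map_act, tmul_balanced])

@[simp] theorem map_tmul {M N : LMod k R} (f : H →ₗ[k] H)
    (hf : ∀ (r : R) (h : H), f (S.β r * h) = S.β r * f h) (g : M.Hom N) (h : H) (m : M.carrier) :
    S.map f hf g (S.tmul M h m) = S.tmul N (f h) (g.toLin m) := rfl

/-- `H ⊗_R M` as a left `R`-module: `r · (h ⊗ m) = α r * h ⊗ m`. -/
@[reducible] def tens (M : LMod k R) : LMod k R where
  carrier := S.Tens M
  act :=
    { toFun := fun r => S.map (LinearMap.mulLeft k (S.α r))
        (fun r' h => by simp [← mul_assoc, S.comm]) ⟨LinearMap.id, fun _ _ => rfl⟩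
      map_one' := S.hom_ext fun h m => by simp
      map_mul' := fun a b => S.hom_ext fun h m => by simp
      map_zero' := S.hom_ext fun h m => by simp [zero_tmul]
      map_add' := fun a b => S.hom_ext fun h m => by
        simp [add_mul, add_tmul]
      commutes' := fun c => S.hom_ext fun h m => by
        simp [Algebra.algebraMap_eq_smul_one, smul_tmul] }

@[simp] theorem tens_act_tmul (M : LMod k R) (r : R) (h : H) (m : M.carrier) :
    (S.tens M).act r (S.tmul M h m) = S.tmul M (S.α r * h) m := rfl

/-- `id ⊗_R g` as a homomorphism of left `R`-modules. -/
def idTens {M N : LMod k R} (g : M.Hom N) : (S.tens M).Hom (S.tens N) where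
  toLin := S.map LinearMap.id (fun _ _ => rfl) g
  map_act := fun r x => by
    refine LinearMap.congr_fun (f := (S.map LinearMap.id (fun _ _ => rfl) g) ∘ₗ (S.tens M).act r)
      (g := (S.tens N).act r ∘ₗ (S.map LinearMap.id (fun _ _ => rfl) g)) ?_ x
    exact S.hom_ext fun h m => by simp

/-- Left multiplication by `β b`, i.e. the right action of `b` on `H`, is left `R`-linear. -/
def mulBeta (b : R) : S.self.Hom S.self where
  toLin := LinearMap.mulLeft k (S.β b)
  map_act := fun r m => by simp [← mul_assoc, S.comm]

/-- The left `R`-linear map `H → H ⊗_R M`, `h ↦ h ⊗ m`. -/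
def tmulRight (M : LMod k R) (m : M.carrier) : S.self.Hom (S.tens M) where
  toLin := (S.tmulBilin M).flip m
  map_act := fun _ _ => rfl

/-- The linear map underlying `tensId`: `h ⊗ m ↦ f h ⊗ m`, under the identification
`(a ⊗ b) ⊗ m = a ⊗ (b ⊗ m)`. -/
def tensIdLin (f : S.self.Hom (S.tens S.self))
    (hf : ∀ (b : R) (x : H), f.toLin (S.β b * x) = (S.idTens (S.mulBeta b)).toLin (f.toLin x))
    (M : LMod k R) : S.Tens M →ₗ[k] S.Tens (S.tens M) :=
  S.lift M
    (LinearMap.mk₂ k (fun h m => (S.idTens (S.tmulRight M m)).toLin (f.toLin h))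
      (fun a b m => by simp) (fun c a m => by simp)
      (fun h m n => by
        refine LinearMap.congr_fun (f := (S.idTens (S.tmulRight M (m + n))).toLin)
          (g := (S.idTens (S.tmulRight M m)).toLin + (S.idTens (S.tmulRight M n)).toLin) ?_ _
        exact S.hom_ext fun a b => by
          simp only [idTens, tmulRight, map_tmul, LinearMap.flip_apply, tmulBilin_apply,
            LinearMap.add_apply, S.tmul_add M b m n, S.tmul_add (S.tens M)])
      (fun c h m => by
        refine LinearMap.congr_fun (f := (S.idTens (S.tmulRight M (c • m))).toLin)
          (g := c • (S.idTens (S.tmulRight M m)).toLin) ?_ _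
        exact S.hom_ext fun a b => by
          simp only [idTens, tmulRight, map_tmul, LinearMap.flip_apply, tmulBilin_apply,
            LinearMap.smul_apply, S.tmul_smul M c b m, S.tmul_smul (S.tens M)]))
    (fun r h m => by
      simp only [LinearMap.mk₂_apply, hf]
      refine LinearMap.congr_fun
        (f := (S.idTens (S.tmulRight M m)).toLin ∘ₗ (S.idTens (S.mulBeta r)).toLin)
        (g := (S.idTens (S.tmulRight M (M.act r m))).toLin) ?_ _
      exact S.hom_ext fun a b => by
        simp [idTens, tmulRight, mulBeta, tmul_balanced])

@[simp] theorem tensIdLin_tmul (f : S.self.Hom (S.tens S.self))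
    (hf : ∀ (b : R) (x : H), f.toLin (S.β b * x) = (S.idTens (S.mulBeta b)).toLin (f.toLin x))
    (M : LMod k R) (h : H) (m : M.carrier) :
    S.tensIdLin f hf M (S.tmul M h m) = (S.idTens (S.tmulRight M m)).toLin (f.toLin h) := rfl

/-- `f ⊗_R id : H ⊗_R M → H ⊗_R H ⊗_R M` for an `(R, R)`-bimodule map `f : H → H ⊗_R H`. -/
def tensId (f : S.self.Hom (S.tens S.self))
    (hf : ∀ (b : R) (x : H), f.toLin (S.β b * x) = (S.idTens (S.mulBeta b)).toLin (f.toLin x))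
    (M : LMod k R) : (S.tens M).Hom (S.tens (S.tens M)) where
  toLin := S.tensIdLin f hf M
  map_act := fun r x => by
    refine LinearMap.congr_fun (f := S.tensIdLin f hf M ∘ₗ (S.tens M).act r)
      (g := (S.tens (S.tens M)).act r ∘ₗ S.tensIdLin f hf M) ?_ x
    refine S.hom_ext fun h m => ?_
    exact (congrArg (S.idTens (S.tmulRight M m)).toLin (f.map_act r h)).trans
      ((S.idTens (S.tmulRight M m)).map_act r _)

/-- For a right `R`-linear `f : H → R`, the map `f ⊗_R id : H ⊗_R H → R ⊗_R H = H`,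
`a ⊗ b ↦ α (f a) * b`. -/
def contractLeft (f : H →ₗ[k] R) (hf : ∀ (b : R) (x : H), f (S.β b * x) = f x * b) :
    S.Tens S.self →ₗ[k] H :=
  S.lift S.self ((LinearMap.mul k H).comp (S.α.toLinearMap.comp f)) (fun r h m => by
    simp [hf, mul_assoc])

/-- For a left `R`-linear `f : H → R`, the map `id ⊗_R f : H ⊗_R H → H ⊗_R R = H`,
`a ⊗ b ↦ β (f b) * a`. -/
def contractRight (f : H →ₗ[k] R) (hf : ∀ (a : R) (x : H), f (S.α a * x) = a * f x) :
    S.Tens S.self →ₗ[k] H :=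
  S.lift S.self ((LinearMap.mul k H).flip.compl₂ (S.β.comp f)) (fun r h m => by
    simp [hf, S.β_mul, mul_assoc])

/-- The `(n+1)`-fold tensor power of `H` over `R`, bracketed to the right. -/
@[reducible] def pow : ℕ → LMod k R
  | 0 => S.self
  | n + 1 => S.tens (pow n)

/-- The spaces of cochains: `R` in degree `0`, the `n`-fold tensor power of `H` over `R`
in degree `n ≥ 1`. -/
@[reducible] def cochain : ℕ → LMod k R
  | 0 => LMod.base k R
  | n + 1 => S.pow n

/-- The map `(h₁, …, hₙ₊₁) ↦ h₁ ⊗_R ⋯ ⊗_R hₙ₊₁ ⊗_R 1`. -/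
def appendOne : ∀ n : ℕ, (S.pow n).Hom (S.pow (n + 1))
  | 0 => S.tmulRight S.self 1
  | n + 1 => S.idTens (appendOne n)

end SourceTarget

/-! ## Bialgebroids -/

/-- A bialgebroid over `k` with base algebra `R` and total algebra `H`. -/
structure Bialgebroid (k : Type v) (R H : Type u) [Field k] [Ring R] [Algebra k R]
    [Ring H] [Algebra k H] extends SourceTarget k R H where
  /-- The coproduct; it is a map of `(R, R)`-bimodules. -/
  comul : toSourceTarget.self.Hom (toSourceTarget.tens toSourceTarget.self)
  comul_right : ∀ (b : R) (x : H), comul.toLin (β b * x) =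
    (toSourceTarget.idTens (toSourceTarget.mulBeta b)).toLin (comul.toLin x)
  comul_one : comul.toLin 1 = toSourceTarget.tmul toSourceTarget.self 1 1
  coassoc : ∀ h : H,
    (toSourceTarget.tensId comul comul_right toSourceTarget.self).toLin (comul.toLin h) =
      (toSourceTarget.idTens comul).toLin (comul.toLin h)
  /-- `Δ(a) (β(r) ⊗ 1 - 1 ⊗ α(r)) = 0` for the right action of `H ⊗ H` on `H ⊗_R H`, computed on
  representatives of `Δ(a)` in `H ⊗ H`. -/
  comul_takeuchi : ∀ (a : H) (r : R) (s : H ⊗[k] H),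
    toSourceTarget.proj toSourceTarget.self s = comul.toLin a →
      toSourceTarget.proj toSourceTarget.self (s * (β r ⊗ₜ[k] 1 - 1 ⊗ₜ[k] α r)) = 0
  /-- `Δ(ab) = Δ(a) Δ(b)`, the product being computed on representatives in `H ⊗ H`. -/
  comul_mul : ∀ (a b : H) (s t : H ⊗[k] H),
    toSourceTarget.proj toSourceTarget.self s = comul.toLin a →
    toSourceTarget.proj toSourceTarget.self t = comul.toLin b →
      comul.toLin (a * b) = toSourceTarget.proj toSourceTarget.self (s * t)
  /-- The counit; it is a map of `(R, R)`-bimodules. -/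
  counit : H →ₗ[k] R
  counit_left : ∀ (a : R) (x : H), counit (α a * x) = a * counit x
  counit_right : ∀ (b : R) (x : H), counit (β b * x) = counit x * b
  counit_one : counit 1 = 1
  counit_comul : ∀ h : H,
    toSourceTarget.contractLeft counit counit_right (comul.toLin h) = h
  comul_counit : ∀ h : H,
    toSourceTarget.contractRight counit counit_left (comul.toLin h) = h

namespace Bialgebroid

variable {k : Type v} {R H : Type u} [Field k] [Ring R] [Algebra k R] [Ring H] [Algebra k H]
variable (B : Bialgebroid k R H)

theorem comul_mul_alpha (h : H) (r : R) :
    B.comul.toLin (h * B.α r) =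
      B.map (LinearMap.mulRight k (B.α r)) (fun _ _ => by simp [mul_assoc])
        (⟨LinearMap.id, fun _ _ => rfl⟩ : B.self.Hom B.self) (B.comul.toLin h) := by
  obtain ⟨s, hs⟩ := B.proj_surjective B.self (B.comul.toLin h)
  have h1 : B.comul.toLin (B.α r) = B.proj B.self (B.α r ⊗ₜ[k] 1) := by
    have := B.comul.map_act r 1
    rw [B.comul_one] at this
    exact (congrArg B.comul.toLin (mul_one _).symm).trans (this.trans (by
      rw [SourceTarget.tens_act_tmul, mul_one]
      rfl))
  rw [B.comul_mul h (B.α r) s _ hs h1.symm, ← hs]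
  refine LinearMap.congr_fun
    (f := B.proj B.self ∘ₗ LinearMap.mulRight k (B.α r ⊗ₜ[k] (1 : H)))
    (g := B.map (LinearMap.mulRight k (B.α r)) (fun _ _ => by simp [mul_assoc])
        (⟨LinearMap.id, fun _ _ => rfl⟩ : B.self.Hom B.self) ∘ₗ B.proj B.self) ?_ s
  refine TensorProduct.ext' fun a b => ?_
  simp only [LinearMap.comp_apply, LinearMap.mulRight_apply, Algebra.TensorProduct.tmul_mul_tmul,
    mul_one]
  rfl

/-- A left action of `H` on an `R`-module `M` by linear maps, compatible on both sides with the
action of `R` through the source map. -/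
structure HAct (M : LMod k R) where
  toLin : H →ₗ[k] Module.End k M.carrier
  alpha_mul : ∀ (r : R) (h : H) (m : M.carrier),
    toLin (B.α r * h) m = M.act r (toLin h m)
  mul_alpha : ∀ (r : R) (h : H) (m : M.carrier),
    toLin (h * B.α r) m = toLin h (M.act r m)

variable {B}

/-- The map `H ⊗_R H → H ⊗_R M`, `a ⊗ b ↦ a g ⊗ b ▷ m`. -/
def HAct.pair {M : LMod k R} (A : B.HAct M) (g : H) (m : M.carrier) :
    B.Tens B.self →ₗ[k] B.Tens M :=
  B.lift B.self ((B.tmulBilin M).compl₁₂ (LinearMap.mulRight k g) (A.toLin.flip m))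
    (fun r h x => by simp [mul_assoc, A.alpha_mul, SourceTarget.tmul_balanced])

@[simp] theorem HAct.pair_tmul {M : LMod k R} (A : B.HAct M) (g : H) (m : M.carrier)
    (a b : H) : A.pair g m (B.tmul B.self a b) = B.tmul M (a * g) (A.toLin b m) := rfl

theorem HAct.pair_balanced {M : LMod k R} (A : B.HAct M) (r : R) (g : H) (m : M.carrier)
    (h : H) : A.pair (B.β r * g) m (B.comul.toLin h) =
      A.pair g (M.act r m) (B.comul.toLin h) := by
  obtain ⟨s, hs⟩ := B.proj_surjective B.self (B.comul.toLin h)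
  have h1 := B.comul_takeuchi h r s hs
  rw [mul_sub, map_sub, sub_eq_zero] at h1
  have h2 := congrArg (A.pair g m) h1
  have h3 : A.pair (B.β r * g) m ∘ₗ B.proj B.self =
      A.pair g m ∘ₗ B.proj B.self ∘ₗ LinearMap.mulRight k (B.β r ⊗ₜ[k] (1 : H)) := by
    refine TensorProduct.ext' fun a b => ?_
    simp only [LinearMap.comp_apply, LinearMap.mulRight_apply,
      Algebra.TensorProduct.tmul_mul_tmul, mul_one]
    change B.tmul M (a * (B.β r * g)) (A.toLin b m) = B.tmul M (a * B.β r * g) (A.toLin b m)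
    rw [mul_assoc]
  have h4 : A.pair g (M.act r m) ∘ₗ B.proj B.self =
      A.pair g m ∘ₗ B.proj B.self ∘ₗ LinearMap.mulRight k ((1 : H) ⊗ₜ[k] B.α r) := by
    refine TensorProduct.ext' fun a b => ?_
    simp only [LinearMap.comp_apply, LinearMap.mulRight_apply,
      Algebra.TensorProduct.tmul_mul_tmul, mul_one]
    change B.tmul M (a * g) (A.toLin b (M.act r m)) = B.tmul M (a * g) (A.toLin (b * B.α r) m)
    rw [A.mul_alpha]
  rw [← hs]
  exact (LinearMap.congr_fun h3 s).trans (h2.trans (LinearMap.congr_fun h4 s).symm)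

theorem HAct.pair_add_left {M : LMod k R} (A : B.HAct M) (g g' : H) (m : M.carrier) :
    A.pair (g + g') m = A.pair g m + A.pair g' m :=
  B.hom_ext fun a b => by simp [mul_add, SourceTarget.add_tmul]

theorem HAct.pair_smul_left {M : LMod k R} (A : B.HAct M) (c : k) (g : H) (m : M.carrier) :
    A.pair (c • g) m = c • A.pair g m :=
  B.hom_ext fun a b => by simp [SourceTarget.smul_tmul]

theorem HAct.pair_add_right {M : LMod k R} (A : B.HAct M) (g : H) (m m' : M.carrier) :
    A.pair g (m + m') = A.pair g m + A.pair g m' :=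
  B.hom_ext fun a b => by simp [SourceTarget.tmul_add]

theorem HAct.pair_smul_right {M : LMod k R} (A : B.HAct M) (c : k) (g : H) (m : M.carrier) :
    A.pair g (c • m) = c • A.pair g m :=
  B.hom_ext fun a b => by simp [SourceTarget.tmul_smul]

/-- The map `g ⊗ m ↦ h⁽¹⁾ g ⊗ h⁽²⁾ ▷ m`. -/
def HAct.tensLin {M : LMod k R} (A : B.HAct M) (h : H) : B.Tens M →ₗ[k] B.Tens M :=
  B.lift M
    (LinearMap.mk₂ k (fun g m => A.pair g m (B.comul.toLin h))
      (fun g g' m => by simp [A.pair_add_left]) (fun c g m => by simp [A.pair_smul_left])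
      (fun g m m' => by simp [A.pair_add_right]) (fun c g m => by simp [A.pair_smul_right]))
    (fun r g m => by simpa using A.pair_balanced r g m h)

@[simp] theorem HAct.tensLin_tmul {M : LMod k R} (A : B.HAct M) (h g : H) (m : M.carrier) :
    A.tensLin h (B.tmul M g m) = A.pair g m (B.comul.toLin h) := rfl

/-- The diagonal action of `H` on `H ⊗_R M`: `h ▷ (g ⊗ m) = h⁽¹⁾ g ⊗ h⁽²⁾ ▷ m`. -/
def HAct.tens {M : LMod k R} (A : B.HAct M) : B.HAct (B.tens M) where
  toLin :=
    { toFun := A.tensLin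
      map_add' := fun h h' => B.hom_ext fun g m => by simp
      map_smul' := fun c h => B.hom_ext fun g m => by simp }
  alpha_mul := fun r h x => by
    refine LinearMap.congr_fun (f := A.tensLin (B.α r * h))
      (g := (B.tens M).act r ∘ₗ A.tensLin h) ?_ x
    refine B.hom_ext fun g m => ?_
    refine (congrArg (A.pair g m) (B.comul.map_act r h)).trans ?_
    refine LinearMap.congr_fun (f := A.pair g m ∘ₗ (B.tens B.self).act r)
      (g := (B.tens M).act r ∘ₗ A.pair g m) ?_ _
    exact B.hom_ext fun a b => by simp [mul_assoc]
  mul_alpha := fun r h x => by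
    refine LinearMap.congr_fun (f := A.tensLin (h * B.α r))
      (g := A.tensLin h ∘ₗ (B.tens M).act r) ?_ x
    refine B.hom_ext fun g m => ?_
    refine (congrArg (A.pair g m) (B.comul_mul_alpha h r)).trans ?_
    refine LinearMap.congr_fun (f := A.pair g m ∘ₗ B.map (LinearMap.mulRight k (B.α r))
        (fun _ _ => by simp [mul_assoc]) (⟨LinearMap.id, fun _ _ => rfl⟩ : B.self.Hom B.self))
      (g := A.pair (B.α r * g) m) ?_ _
    refine B.hom_ext fun a b => ?_
    change B.tmul M (a * B.α r * g) (A.toLin b m) = B.tmul M (a * (B.α r * g)) (A.toLin b m)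
    rw [mul_assoc]

variable (B)

/-- The diagonal action of `H` on its `(n+1)`-fold tensor power over `R`:
`h ▷ (g₁ ⊗ ⋯ ⊗ gₙ₊₁) = h⁽¹⁾ g₁ ⊗ ⋯ ⊗ h⁽ⁿ⁺¹⁾ gₙ₊₁ = Δⁿ(h) · (g₁ ⊗ ⋯ ⊗ gₙ₊₁)`. -/
def diag : ∀ n : ℕ, B.HAct (B.pow n)
  | 0 =>
    { toLin := (Algebra.lmul k H).toLinearMap
      alpha_mul := fun r h m => by simp [mul_assoc]
      mul_alpha := fun r h m => by simp [mul_assoc] }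
  | n + 1 => (diag n).tens

/-- `h₁ ⊗ ⋯ ⊗ hₙ₊₁ ↦ h₁ ⊗ ⋯ ⊗ Δ(hᵢ₊₁) ⊗ ⋯ ⊗ hₙ₊₁` for `0 ≤ i ≤ n`, and
`h₁ ⊗ ⋯ ⊗ hₙ₊₁ ↦ h₁ ⊗ ⋯ ⊗ hₙ₊₁ ⊗ 1` for `i = n + 1` (larger `i` are not used). -/
def innerCoface : ∀ n : ℕ, ℕ → (B.pow n).Hom (B.pow (n + 1))
  | 0, 0 => B.comul
  | 0, _ + 1 => B.appendOne 0
  | n + 1, 0 => B.tensId B.comul B.comul_right (B.pow n)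
  | n + 1, i + 1 => B.idTens (innerCoface n i)

/-- The cofaces `δᵢ`, `0 ≤ i ≤ n + 1`, in degree `n` (larger `i` are not used). -/
def coface : ∀ n : ℕ, ℕ → ((B.cochain n).carrier →ₗ[k] (B.cochain (n + 1)).carrier)
  | 0, 0 => B.α.toLinearMap
  | 0, _ + 1 => B.β
  | n + 1, 0 => B.tmulBilin (B.pow n) 1
  | n + 1, i + 1 => (B.innerCoface n i).toLin

/-- The Hochschild coboundary `b = ∑ (-1)ⁱ δᵢ`. -/
def b (n : ℕ) : (B.cochain n).carrier →ₗ[k] (B.cochain (n + 1)).carrier :=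
  ∑ i ∈ Finset.range (n + 2), (-1 : k) ^ i • B.coface n i

/-- A left Haar system: a right `R`-module map `t : H → R` with
`α(t(h⁽¹⁾)) h⁽²⁾ = α(t(h)) 1` and `α t = β t`. -/
structure IsLeftHaarSystem (t : H →ₗ[k] R) : Prop where
  map_right : ∀ (r : R) (h : H), t (B.β r * h) = t h * r
  invariant : ∀ h : H, B.contractLeft t map_right (B.comul.toLin h) = B.α (t h) * 1
  alpha_eq_beta : ∀ h : H, B.α (t h) = B.β (t h)

/-- A left Haar system is normal if it sends `1` to `1`. -/
structure IsNormalLeftHaarSystem (t : H →ₗ[k] R) : Prop extends B.IsLeftHaarSystem t where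
  map_one : t 1 = 1

end Bialgebroid

/-! ## Para-Hopf algebroids -/

/-- A bialgebroid together with an anti-algebra map `T` of `H` with `T β = α`. -/
structure BialgebroidWithAntiMap (k : Type v) (R H : Type u) [Field k] [Ring R] [Algebra k R]
    [Ring H] [Algebra k H] extends Bialgebroid k R H where
  T : H →ₗ[k] H
  T_one : T 1 = 1
  T_mul : ∀ x y : H, T (x * y) = T y * T x
  T_beta : ∀ r : R, T (β r) = α r

namespace BialgebroidWithAntiMap

variable {k : Type v} {R H : Type u} [Field k] [Ring R] [Algebra k R] [Ring H] [Algebra k H]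
variable (P : BialgebroidWithAntiMap k R H)

/-- The map `m (T ⊗ id) : H ⊗_R H → H`, `x ⊗ y ↦ T x * y`. -/
def mulT : P.Tens P.self →ₗ[k] H :=
  P.lift P.self ((LinearMap.mul k H).comp P.T)
    (fun r h m => by simp [P.T_mul, P.T_beta, mul_assoc])

/-- The cyclic operator on the tensor powers `H ⊗_R ⋯ ⊗_R H`:
`h₁ ⊗ h₂ ⊗ ⋯ ⊗ hₙ ↦ T(h₁) ▷ (h₂ ⊗ ⋯ ⊗ hₙ ⊗ 1) = Δⁿ⁻¹(T(h₁)) · (h₂ ⊗ ⋯ ⊗ hₙ ⊗ 1)`. -/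
def cyclicPow : ∀ n : ℕ, (P.pow n).carrier →ₗ[k] (P.pow n).carrier
  | 0 => P.T
  | n + 1 => P.lift (P.pow n)
      (((P.diag (n + 1)).toLin.comp P.T).compl₂ (P.appendOne n).toLin)
      (fun r h m => by
        simp only [LinearMap.compl₂_apply, LinearMap.comp_apply, P.T_mul, P.T_beta,
          (P.appendOne n).map_act]
        exact (P.diag (n + 1)).mul_alpha r _ _)

/-- The cyclic operator on cochains; it is the identity in degree `0`. -/
def cyclic : ∀ n : ℕ, (P.cochain n).carrier →ₗ[k] (P.cochain n).carrier
  | 0 => LinearMap.id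
  | n + 1 => P.cyclicPow n

end BialgebroidWithAntiMap

/-- A para-Hopf algebroid `(H, R, α, β, Δ, ε, T)`. -/
structure ParaHopfAlgebroid (k : Type v) (R H : Type u) [Field k] [Ring R] [Algebra k R]
    [Ring H] [Algebra k H] extends BialgebroidWithAntiMap k R H where
  /-- `m (T ⊗ id) Δ = β ε T`. -/
  mulT_comul : ∀ h : H,
    toBialgebroidWithAntiMap.mulT (comul.toLin h) = β (counit (T h))
  T_T : ∀ h : H, T (T h) = h
  /-- `T(h⁽¹⁾)⁽¹⁾ h⁽²⁾ ⊗_R T(h⁽¹⁾)⁽²⁾ = 1 ⊗_R T(h)`; the left-hand side is the image of `Δ(h)`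
  under `x ⊗ y ↦ Δ(T(x)) · (y ⊗ 1)`. -/
  cyclic_comul : ∀ h : H, toBialgebroidWithAntiMap.cyclicPow 1 (comul.toLin h) =
    toSourceTarget.tmul toSourceTarget.self 1 (T h)

namespace ParaHopfAlgebroid

variable {k : Type v} {R H : Type u} [Field k] [Ring R] [Algebra k R] [Ring H] [Algebra k H]
variable (P : ParaHopfAlgebroid k R H)

/-- Connes' cyclic cochains: the `n`-cochains `x` with `τₙ x = (-1)ⁿ x`. -/
def cyclicCochains (n : ℕ) : Submodule k (P.cochain n).carrier :=
  LinearMap.ker (P.cyclic n - (-1 : k) ^ n • LinearMap.id)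

/-- The cyclic `n`-cocycles. -/
def cyclicCocycles (n : ℕ) : Submodule k (P.cochain n).carrier :=
  P.cyclicCochains n ⊓ LinearMap.ker (P.b n)

/-- The coboundaries of cyclic cochains. -/
def cyclicCoboundaries : ∀ n : ℕ, Submodule k (P.cochain n).carrier
  | 0 => ⊥
  | n + 1 => (P.cyclicCochains n).map (P.b n)

/-- The cyclic cohomology `HCⁿ` of a para-Hopf algebroid, i.e. the cohomology of the complex of
cyclic cochains of its cocyclic module: cyclic cocycles modulo coboundaries of cyclic cochains. -/
abbrev HC (n : ℕ) : Type u :=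
  (P.cyclicCocycles n) ⧸ (P.cyclicCoboundaries n).comap (P.cyclicCocycles n).subtype

end ParaHopfAlgebroid

end ParaHopf

/-!
The cofaces and the cyclic operator of a para-Hopf algebroid form a cocyclic module (degeneracies
are not needed), and a normal left Haar system `t` contracts it: the maps
`s (h₀ ⊗ ⋯ ⊗ hₙ) = α(t(h₀)) h₁ ⊗ ⋯ ⊗ hₙ` satisfy `s δ₀ = id` and `s δᵢ₊₁ = δᵢ s`
(`haarContraction`). Let `b'` be the Hochschild coboundary `b` without its last coface,
`λ = (-1)ⁿ τₙ` and `N = 1 + λ + ⋯ + λⁿ`. The contraction makes `(C, b')` acyclic and `(C, b)`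
acyclic in positive degrees.

The relations `(1 - λ) b = b' (1 - λ)` and `N b' = b N`, together with `ker (1 - λ) = im N` and
`ker N = im (1 - λ)`, which hold since `λⁿ⁺¹ = 1` and the characteristic is zero, give short exact
sequences `0 → ker (1 - λ) → (C, b) → ker N → 0` and `0 → ker N → (C, b') → ker (1 - λ) → 0` of
complexes. By acyclicity `HCⁿ ≅ HCⁿ⁺²`; the isomorphism is realised by the zigzag
`x = N y`, `b' y = (1 - λ) z`, `b z = w` (`PreCocyclic.Contraction.periodic`). In low degrees
`HC⁰ = ker b` and `HC¹ = 0`, because every `0`-cochain is cyclic and `ker b = im b` in degree `1`.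

That the module is cocyclic rests on two facts about the diagonal action `▷` of `H` on its tensor
powers over `R`. By coassociativity and multiplicativity of `Δ`, the inner cofaces commute with the
action (`innerCoface_equivariant`), which gives `τ δᵢ = δᵢ₋₁ τ` for `i ≥ 2`; the case `i = 1` is the
defining identity of a para-Hopf algebroid. Also by coassociativity,
`v ▷ (y ⊗ 1) = (v⁽¹⁾ ▷ y) ⊗ v⁽²⁾` (`diag_append_one`), so the defining identity extends to
`T(u⁽¹⁾) ▷ ((u⁽²⁾ ▷ y) ⊗ 1) = y ⊗ T(u)` (`cyclicPow_succ_act`). It follows that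
`τ (T(g₀) ▷ (g₁ ⊗ ⋯ ⊗ gₙ)) = T(g₁) ▷ (g₂ ⊗ ⋯ ⊗ gₙ ⊗ g₀)`, and taking `g₀ = 1` one finds `τⁿ⁺¹ = 1`.

In degree `0` the cosimplicial identities require `δ₀ = β` and `δ₁ = α`, the opposite of the
convention used for `coface`. Exchanging the two changes the sign of `b` in degree `0`, hence
neither the cocycles nor the coboundaries.
-/

namespace ParaHopf

/-! ### Isomorphisms of subquotients -/

/-- Two subquotients `Z₁ / B₁` and `Z₂ / B₂` are isomorphic if some linear relation `G`
between `Z₁` and `Z₂` is surjective on both sides and matches `B₁` with `B₂`. -/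
theorem nonempty_quotient_equiv_of_relation {k V W : Type*} [Field k] [AddCommGroup V] [Module k V]
    [AddCommGroup W] [Module k W] {Z₁ B₁ : Submodule k V} {Z₂ B₂ : Submodule k W}
    (G : Submodule k (V × W)) (hG₁ : ∀ p ∈ G, p.1 ∈ Z₁) (hG₂ : ∀ p ∈ G, p.2 ∈ Z₂)
    (h₁ : ∀ x ∈ Z₁, ∃ w, (x, w) ∈ G) (h₂ : ∀ w ∈ Z₂, ∃ x, (x, w) ∈ G)
    (hB : ∀ p ∈ G, p.1 ∈ B₁ ↔ p.2 ∈ B₂) :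
    Nonempty ((Z₁ ⧸ B₁.comap Z₁.subtype) ≃ₗ[k] (Z₂ ⧸ B₂.comap Z₂.subtype)) := by
  let f₁ : G →ₗ[k] Z₁ ⧸ B₁.comap Z₁.subtype := (Submodule.mkQ _).comp
    (((LinearMap.fst k V W).comp G.subtype).codRestrict Z₁ fun p => hG₁ p p.2)
  let f₂ : G →ₗ[k] Z₂ ⧸ B₂.comap Z₂.subtype := (Submodule.mkQ _).comp
    (((LinearMap.snd k V W).comp G.subtype).codRestrict Z₂ fun p => hG₂ p p.2)
  have s₁ : Function.Surjective f₁ := by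
    intro q
    obtain ⟨⟨x, hx⟩, rfl⟩ := Submodule.mkQ_surjective _ q
    obtain ⟨w, hw⟩ := h₁ x hx
    exact ⟨⟨_, hw⟩, rfl⟩
  have s₂ : Function.Surjective f₂ := by
    intro q
    obtain ⟨⟨x, hx⟩, rfl⟩ := Submodule.mkQ_surjective _ q
    obtain ⟨w, hw⟩ := h₂ x hx
    exact ⟨⟨_, hw⟩, rfl⟩
  have hker : LinearMap.ker f₁ = LinearMap.ker f₂ := by
    ext p
    have e₁ : p ∈ LinearMap.ker f₁ ↔ p.1.1 ∈ B₁ :=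
      LinearMap.mem_ker.trans (Submodule.Quotient.mk_eq_zero _)
    have e₂ : p ∈ LinearMap.ker f₂ ↔ p.1.2 ∈ B₂ :=
      LinearMap.mem_ker.trans (Submodule.Quotient.mk_eq_zero _)
    rw [e₁, e₂, hB p p.2]
  exact ⟨(f₁.quotKerEquivOfSurjective s₁).symm ≪≫ₗ Submodule.quotEquivOfEq _ _ hker ≪≫ₗ
    f₂.quotKerEquivOfSurjective s₂⟩

/-! ### Cocyclic modules -/

/-- A cocyclic module without degeneracies. Of the cosimplicial identities only those with
`δ₀` on the right are required: conjugation by the cyclic operator yields the others. The maps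
`δ n i` with `i > n + 1` play no role. -/
structure PreCocyclic (k : Type v) [Field k] (C : ℕ → Type u) [∀ n, AddCommGroup (C n)]
    [∀ n, Module k (C n)] where
  δ : ∀ n : ℕ, ℕ → C n →ₗ[k] C (n + 1)
  τ : ∀ n : ℕ, Module.End k (C n)
  δ_succ_δ_zero : ∀ n j, j ≤ n + 1 → ∀ x, δ (n + 1) (j + 1) (δ n 0 x) = δ (n + 1) 0 (δ n j x)
  τ_δ_zero : ∀ n x, τ (n + 1) (δ n 0 x) = δ n (n + 1) x
  τ_δ_succ : ∀ n i, i ≤ n → ∀ x, τ (n + 1) (δ n (i + 1) x) = δ n i (τ n x)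
  τ_pow : ∀ n, τ n ^ (n + 1) = 1

/-- The cosimplicial identities make consecutive alternating sums of cofaces compose to zero. -/
theorem sum_alternating_comp_eq_zero {k U V W : Type*} [Field k] [AddCommGroup U] [Module k U]
    [AddCommGroup V] [Module k V] [AddCommGroup W] [Module k W] (m : ℕ)
    (f : ℕ → V →ₗ[k] W) (g : ℕ → U →ₗ[k] V) (x : U)
    (h : ∀ i j, i ≤ j → j < m → f (j + 1) (g i x) = f i (g j x)) :
    (∑ j ∈ Finset.range (m + 1), (-1 : k) ^ j • f j)
      ((∑ i ∈ Finset.range m, (-1 : k) ^ i • g i) x) = 0 := by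
  simp only [LinearMap.sum_apply, LinearMap.smul_apply, map_sum, map_smul]
  induction m with
  | zero => simp
  | succ m ih =>
    have key : ∀ i ≤ m, f (m + 1) (g i x) = f i (g m x) := fun i hi => h i m hi (by omega)
    rw [Finset.sum_range_succ]
    simp only [Finset.sum_range_succ _ (m + 1)]
    simp only [smul_add, Finset.sum_add_distrib]
    rw [ih fun i j hij hj => h i j hij (by omega)]
    rw [zero_add, key m le_rfl]
    have : ∑ i ∈ Finset.range m, (-1 : k) ^ i • (-1 : k) ^ (m + 1) • f (m + 1) (g i x) =
        - ((-1 : k) ^ m • ∑ i ∈ Finset.range m, (-1 : k) ^ i • f i (g m x)) := by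
      rw [Finset.smul_sum, ← Finset.sum_neg_distrib]
      refine Finset.sum_congr rfl fun i hi => ?_
      rw [key i (by simp at hi; omega), smul_smul, smul_smul, pow_succ, ← neg_smul]
      congr 1
      ring
    rw [this, Finset.sum_range_succ, smul_add, pow_succ]
    module

namespace PreCocyclic

variable {k : Type v} [Field k] {C : ℕ → Type u} [∀ n, AddCommGroup (C n)] [∀ n, Module k (C n)]
variable (M : PreCocyclic k C)

/-- The Hochschild coboundary. -/
def b (n : ℕ) : C n →ₗ[k] C (n + 1) := ∑ i ∈ Finset.range (n + 2), (-1 : k) ^ i • M.δ n i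

/-- The Hochschild coboundary with the last coface left out. -/
def b' (n : ℕ) : C n →ₗ[k] C (n + 1) := ∑ i ∈ Finset.range (n + 1), (-1 : k) ^ i • M.δ n i

/-- The signed cyclic operator `(-1)ⁿ τₙ`. -/
def lam (n : ℕ) : Module.End k (C n) := (-1 : k) ^ n • M.τ n

/-- The norm operator `1 + λ + ⋯ + λⁿ`. -/
def norm (n : ℕ) : Module.End k (C n) := ∑ i ∈ Finset.range (n + 1), M.lam n ^ i

theorem τ_pow_δ (n i j : ℕ) (h : i + j ≤ n + 1) (x : C n) :
    (M.τ (n + 1) ^ j) (M.δ n (i + j) x) = M.δ n i ((M.τ n ^ j) x) := by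
  induction j generalizing x with
  | zero => rfl
  | succ j ih =>
    rw [pow_succ, Module.End.mul_apply, ← add_assoc, M.τ_δ_succ n (i + j) (by omega),
      ih (by omega), pow_succ, Module.End.mul_apply]

theorem τ_pow_injective (n j : ℕ) : Function.Injective (M.τ n ^ j) := by
  rw [Module.End.coe_pow]
  refine Function.Injective.iterate (fun x y h => ?_) j
  have := congrArg (M.τ n ^ n) h
  rwa [← Module.End.mul_apply, ← Module.End.mul_apply, ← pow_succ, M.τ_pow] at this

/-- The cosimplicial identities. -/
theorem δ_comm (n i j : ℕ) (hij : i ≤ j) (hj : j ≤ n + 1) (x : C n) :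
    M.δ (n + 1) (j + 1) (M.δ n i x) = M.δ (n + 1) i (M.δ n j x) := by
  obtain ⟨d, rfl⟩ := Nat.exists_eq_add_of_le' hij
  -- `τ ^ i` turns both sides into `δ₀ δ_{j - i} τ ^ i`
  apply M.τ_pow_injective _ i
  have h1 := M.τ_pow_δ (n + 1) (d + 1) i (by omega) (M.δ n i x)
  have h2 := M.τ_pow_δ (n + 1) 0 i (by omega) (M.δ n (d + i) x)
  have h3 := M.τ_pow_δ n 0 i (by omega) x
  rw [zero_add] at h2 h3
  rw [show d + i + 1 = d + 1 + i by omega, h1, h2, h3, M.τ_pow_δ n d i (by omega),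
    M.δ_succ_δ_zero _ _ (by omega)]

theorem b_b (n : ℕ) (x : C n) : M.b (n + 1) (M.b n x) = 0 :=
  sum_alternating_comp_eq_zero (n + 2) _ _ x fun i j hij hj => M.δ_comm n i j hij (by omega) x

theorem b'_b' (n : ℕ) (x : C n) : M.b' (n + 1) (M.b' n x) = 0 :=
  sum_alternating_comp_eq_zero (n + 1) _ _ x fun i j hij hj => M.δ_comm n i j hij (by omega) x

theorem lam_pow (n : ℕ) : M.lam n ^ (n + 1) = 1 := by
  rw [lam, smul_pow, M.τ_pow, ← pow_mul, (Nat.even_mul_succ_self n).neg_one_pow, one_smul]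

/-- With the signs absorbed, `λ` lowers the index of a coface without changing the sign. -/
theorem lam_smul_δ_succ (n i : ℕ) (h : i ≤ n) (x : C n) :
    M.lam (n + 1) ((-1 : k) ^ (i + 1) • M.δ n (i + 1) x) =
      (-1 : k) ^ i • M.δ n i (M.lam n x) := by
  simp only [lam, LinearMap.smul_apply, map_smul, M.τ_δ_succ n i h, smul_smul, pow_succ]
  congr 1
  ring

theorem lam_δ_zero (n : ℕ) (x : C n) :
    M.lam (n + 1) (M.δ n 0 x) = (-1 : k) ^ (n + 1) • M.δ n (n + 1) x := by
  rw [lam, LinearMap.smul_apply, M.τ_δ_zero]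

theorem b_eq (n : ℕ) (x : C n) :
    M.b n x = M.b' n x + (-1 : k) ^ (n + 1) • M.δ n (n + 1) x := by
  rw [b, Finset.sum_range_succ]
  rfl

theorem lam_b (n : ℕ) (x : C n) :
    M.lam (n + 1) (M.b n x) = M.b n x - M.b' n x + M.b' n (M.lam n x) := by
  have h : M.lam (n + 1) (M.b n x) = M.b' n (M.lam n x) + M.lam (n + 1) (M.δ n 0 x) := by
    rw [b, Finset.sum_range_succ', LinearMap.add_apply, map_add, LinearMap.sum_apply, map_sum, b',
      LinearMap.sum_apply, pow_zero, one_smul]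
    congr 1
    refine Finset.sum_congr rfl fun i hi => ?_
    exact M.lam_smul_δ_succ n i (by simp at hi; omega) x
  rw [h, M.lam_δ_zero, M.b_eq]
  abel

/-- `(1 - λ) b = b' (1 - λ)`. -/
theorem sub_lam_b (n : ℕ) (x : C n) :
    M.b n x - M.lam (n + 1) (M.b n x) = M.b' n (x - M.lam n x) := by
  rw [lam_b, map_sub]
  abel

theorem lam_mul_norm (n : ℕ) : M.lam n * M.norm n = M.norm n := by
  have h := mul_neg_geom_sum (M.lam n) (n + 1)
  rwa [M.lam_pow, sub_self, sub_mul, one_mul, sub_eq_zero, eq_comm] at h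

theorem norm_mul_lam (n : ℕ) : M.norm n * M.lam n = M.norm n := by
  have h := geom_sum_mul_neg (M.lam n) (n + 1)
  rwa [M.lam_pow, sub_self, mul_sub, mul_one, sub_eq_zero, eq_comm] at h

theorem lam_norm (n : ℕ) (x : C n) : M.lam n (M.norm n x) = M.norm n x :=
  LinearMap.congr_fun (M.lam_mul_norm n) x

theorem norm_lam (n : ℕ) (x : C n) : M.norm n (M.lam n x) = M.norm n x :=
  LinearMap.congr_fun (M.norm_mul_lam n) x

/-- `N δ₀` determines `N δᵢ`, since `N λ = N`. -/
theorem norm_smul_δ (n i : ℕ) (h : i ≤ n + 1) (x : C n) :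
    M.norm (n + 1) ((-1 : k) ^ i • M.δ n i x) = M.norm (n + 1) (M.δ n 0 ((M.lam n ^ i) x)) := by
  induction i generalizing x with
  | zero => simp
  | succ i ih =>
    rw [← norm_lam, M.lam_smul_δ_succ n i (by omega), ih (by omega), pow_succ,
      Module.End.mul_apply]

theorem lam_pow_smul_δ (n i j : ℕ) (h : i + j ≤ n + 1) (x : C n) :
    (M.lam (n + 1) ^ j) ((-1 : k) ^ (i + j) • M.δ n (i + j) x) =
      (-1 : k) ^ i • M.δ n i ((M.lam n ^ j) x) := by
  induction j generalizing x with
  | zero => rfl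
  | succ j ih =>
    rw [pow_succ, Module.End.mul_apply, ← add_assoc, M.lam_smul_δ_succ n (i + j) (by omega),
      ih (by omega), pow_succ, Module.End.mul_apply]

/-- On cyclic cochains the Hochschild coboundary is the norm of the first coface. -/
theorem norm_δ_zero (n : ℕ) (x : C n) (hx : M.lam n x = x) :
    M.norm (n + 1) (M.δ n 0 x) = M.b n x := by
  have hpow : ∀ j, (M.lam n ^ j) x = x := fun j => by
    induction j with
    | zero => rfl
    | succ j ih => rw [pow_succ, Module.End.mul_apply, hx, ih]
  rw [norm, b, LinearMap.sum_apply, LinearMap.sum_apply, Finset.sum_range_succ',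
    Finset.sum_range_succ' (fun i => ((-1 : k) ^ i • M.δ n i) x), pow_zero, pow_zero, one_smul,
    Module.End.one_apply]
  congr 1
  rw [← Finset.sum_range_reflect]
  refine Finset.sum_congr rfl fun i hi => ?_
  have hi' : i ≤ n := by simp at hi; omega
  have h := M.lam_pow_smul_δ n (i + 1) (n - i) (by omega) x
  rw [show i + 1 + (n - i) = n + 1 by omega, ← lam_δ_zero, hpow] at h
  rw [show n + 1 - 1 - i + 1 = (n - i) + 1 by omega, pow_succ, Module.End.mul_apply, h,
    LinearMap.smul_apply]

/-- `N b' = b N`: both are equal to `N δ₀ N`. -/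
theorem norm_b' (n : ℕ) (x : C n) : M.norm (n + 1) (M.b' n x) = M.b n (M.norm n x) := by
  rw [← M.norm_δ_zero n _ (M.lam_norm n x), b', norm.eq_def M n, LinearMap.sum_apply,
    LinearMap.sum_apply, map_sum, map_sum, map_sum]
  refine Finset.sum_congr rfl fun i hi => ?_
  exact M.norm_smul_δ n i (by simp at hi; omega) x

/-- `ker (1 - λ) = im N` in characteristic zero. -/
theorem exists_norm_eq [CharZero k] (n : ℕ) (x : C n) (hx : M.lam n x = x) :
    ∃ y, M.norm n y = x := by
  have hpow : ∀ j, (M.lam n ^ j) x = x := fun j => by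
    induction j with
    | zero => rfl
    | succ j ih => rw [pow_succ, Module.End.mul_apply, hx, ih]
  refine ⟨((n + 1 : ℕ) : k)⁻¹ • x, ?_⟩
  have hn : ((n + 1 : ℕ) : k) ≠ 0 := Nat.cast_ne_zero.2 n.succ_ne_zero
  rw [map_smul, norm, LinearMap.sum_apply, Finset.sum_congr rfl fun i _ => hpow i,
    Finset.sum_const, Finset.card_range, ← Nat.cast_smul_eq_nsmul k, smul_smul,
    inv_mul_cancel₀ hn, one_smul]

/-- `ker N = im (1 - λ)` in characteristic zero. -/
theorem exists_sub_lam_eq [CharZero k] (n : ℕ) (y : C n) (hy : M.norm n y = 0) :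
    ∃ v, v - M.lam n v = y := by
  have hn : ((n + 1 : ℕ) : k) ≠ 0 := Nat.cast_ne_zero.2 n.succ_ne_zero
  -- `(n + 1) y = ∑ i ≤ n, (y - λⁱ y)`, and `1 - λ` divides each `1 - λⁱ`
  have h : ∀ i, (∑ j ∈ Finset.range i, M.lam n ^ j) y -
      M.lam n ((∑ j ∈ Finset.range i, M.lam n ^ j) y) = y - (M.lam n ^ i) y := fun i => by
    have := LinearMap.congr_fun (mul_neg_geom_sum (M.lam n) i) y
    simpa only [Module.End.mul_apply, LinearMap.sub_apply, Module.End.one_apply] using this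
  refine ⟨((n + 1 : ℕ) : k)⁻¹ •
    ∑ i ∈ Finset.range (n + 1), (∑ j ∈ Finset.range i, M.lam n ^ j) y, ?_⟩
  have hy' : ∑ i ∈ Finset.range (n + 1), (M.lam n ^ i) y = 0 := by
    rwa [norm, LinearMap.sum_apply] at hy
  rw [map_smul, ← smul_sub, map_sum, ← Finset.sum_sub_distrib,
    Finset.sum_congr rfl fun i _ => h i, Finset.sum_sub_distrib, hy', sub_zero,
    Finset.sum_const, Finset.card_range, ← Nat.cast_smul_eq_nsmul k, smul_smul,
    inv_mul_cancel₀ hn, one_smul]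

/-! ### Cyclic cohomology of a contractible cocyclic module -/

/-- A contraction of a cocyclic module: an extra degeneracy `s` with `s δ₀ = id` and
`s δᵢ₊₁ = δᵢ s`. -/
structure Contraction where
  s : ∀ n, C (n + 1) →ₗ[k] C n
  s_δ_zero : ∀ n x, s n (M.δ n 0 x) = x
  s_δ_succ : ∀ n i, i ≤ n + 1 → ∀ x, s (n + 1) (M.δ (n + 1) (i + 1) x) = M.δ n i (s n x)

namespace Contraction

variable {M}

/-- A contraction is a contracting homotopy for `b'`. -/
theorem s_b' (c : M.Contraction) (n : ℕ) (x : C (n + 1)) :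
    c.s (n + 1) (M.b' (n + 1) x) + M.b' n (c.s n x) = x := by
  rw [b', Finset.sum_range_succ', LinearMap.add_apply, map_add, pow_zero, one_smul, c.s_δ_zero,
    LinearMap.sum_apply, map_sum, b', LinearMap.sum_apply, add_right_comm,
    ← Finset.sum_add_distrib, Finset.sum_eq_zero, zero_add]
  intro i hi
  rw [LinearMap.smul_apply, map_smul, c.s_δ_succ n i (by simp at hi; omega), pow_succ,
    LinearMap.smul_apply]
  module

/-- In positive degrees, a contraction is also a contracting homotopy for `b`: the additional
summands of `b` cancel because `s` carries the last coface to the last coface. -/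
theorem s_b (c : M.Contraction) (n : ℕ) (x : C (n + 1)) :
    c.s (n + 1) (M.b (n + 1) x) + M.b n (c.s n x) = x := by
  rw [b_eq, b_eq, map_add, map_smul, c.s_δ_succ n (n + 1) le_rfl, pow_succ (-1 : k) (n + 1)]
  conv_rhs => rw [← c.s_b' n x]
  module

/-- In degree `0` the map `b'` is `δ₀`, which `s` splits. -/
theorem eq_zero_of_b'_zero (c : M.Contraction) (x : C 0) (hx : M.b' 0 x = 0) : x = 0 := by
  have h : M.b' 0 x = M.δ 0 0 x := by simp [b']
  rw [← c.s_δ_zero 0 x, ← h, hx, map_zero]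

theorem exists_b'_eq (c : M.Contraction) (n : ℕ) (x : C (n + 1)) (hx : M.b' (n + 1) x = 0) :
    ∃ y, M.b' n y = x :=
  ⟨c.s n x, by simpa [hx] using c.s_b' n x⟩

theorem exists_b_eq (c : M.Contraction) (n : ℕ) (x : C (n + 1)) (hx : M.b (n + 1) x = 0) :
    ∃ y, M.b n y = x :=
  ⟨c.s n x, by simpa [hx] using c.s_b n x⟩

end Contraction

/-- Connes' cyclic cochains, the `n`-cochains `x` with `τₙ x = (-1)ⁿ x`. -/
def cyclicCochains (n : ℕ) : Submodule k (C n) :=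
  LinearMap.ker (M.τ n - (-1 : k) ^ n • LinearMap.id)

/-- The cyclic cocycles. -/
def cyclicCocycles (n : ℕ) : Submodule k (C n) := M.cyclicCochains n ⊓ LinearMap.ker (M.b n)

/-- The coboundaries of cyclic cochains. -/
def cyclicCoboundaries : ∀ n : ℕ, Submodule k (C n)
  | 0 => ⊥
  | n + 1 => (M.cyclicCochains n).map (M.b n)

/-- The cohomology of the complex of cyclic cochains. -/
abbrev HC (n : ℕ) : Type u :=
  (M.cyclicCocycles n) ⧸ (M.cyclicCoboundaries n).comap (M.cyclicCocycles n).subtype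

theorem mem_cyclicCochains (n : ℕ) (x : C n) : x ∈ M.cyclicCochains n ↔ M.lam n x = x := by
  rw [cyclicCochains, LinearMap.mem_ker, LinearMap.sub_apply, sub_eq_zero, lam,
    LinearMap.smul_apply, LinearMap.smul_apply, LinearMap.id_apply]
  have h : (-1 : k) ^ n * (-1) ^ n = 1 := by rw [← mul_pow]; simp
  constructor <;> intro hx
  · rw [hx, smul_smul, h, one_smul]
  · conv_rhs => rw [← hx, smul_smul, h, one_smul]

theorem mem_cyclicCocycles (n : ℕ) (x : C n) :
    x ∈ M.cyclicCocycles n ↔ M.lam n x = x ∧ M.b n x = 0 := by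
  rw [cyclicCocycles, Submodule.mem_inf, mem_cyclicCochains, LinearMap.mem_ker]

theorem mem_cyclicCoboundaries_succ (n : ℕ) (x : C (n + 1)) :
    x ∈ M.cyclicCoboundaries (n + 1) ↔ ∃ w, M.lam n w = w ∧ M.b n w = x := by
  simp [cyclicCoboundaries, Submodule.mem_map, mem_cyclicCochains]

theorem lam_zero (x : C 0) : M.lam 0 x = x := by
  have h := M.lam_pow 0
  rw [zero_add, pow_one] at h
  rw [h, Module.End.one_apply]

/-- The zigzag relation between `n`-cochains and `(n + 2)`-cochains that represents Connes'
periodicity operator: `x` and `w` are related if `x = N y`, `b' y = (1 - λ) z` and `b z = w`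
for some `y` and `z`. -/
def periodicity (n : ℕ) : Submodule k (C n × C (n + 2)) :=
  (LinearMap.ker ((M.b' n).comp (LinearMap.fst k (C n) (C (n + 1))) -
    (1 - M.lam (n + 1)).comp (LinearMap.snd k (C n) (C (n + 1))))).map
    ((M.norm n).prodMap (M.b (n + 1)))

theorem mem_periodicity (n : ℕ) (x : C n) (w : C (n + 2)) :
    (x, w) ∈ M.periodicity n ↔ ∃ y z, M.b' n y = z - M.lam (n + 1) z ∧
      M.norm n y = x ∧ M.b (n + 1) z = w := by
  simp [periodicity, Submodule.mem_map, LinearMap.mem_ker, sub_eq_zero]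

variable {M}

/-- The periodicity relation descends to an isomorphism because the complexes `(C, b')` and, in
positive degrees, `(C, b)` are acyclic, while the sequence formed by `1 - λ` and `N` is exact. -/
theorem Contraction.periodic [CharZero k] (c : M.Contraction) (n : ℕ) :
    Nonempty (M.HC n ≃ₗ[k] M.HC (n + 2)) := by
  refine nonempty_quotient_equiv_of_relation (M.periodicity n) ?_ ?_ ?_ ?_ ?_
  · rintro ⟨x, w⟩ h
    obtain ⟨y, z, hyz, rfl, rfl⟩ := (M.mem_periodicity n x w).1 h
    refine (M.mem_cyclicCocycles n _).2 ⟨M.lam_norm n y, ?_⟩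
    rw [← norm_b', hyz, map_sub, norm_lam, sub_self]
  · rintro ⟨x, w⟩ h
    obtain ⟨y, z, hyz, rfl, rfl⟩ := (M.mem_periodicity n x w).1 h
    refine (M.mem_cyclicCocycles (n + 2) _).2 ⟨?_, M.b_b _ z⟩
    rw [eq_comm, ← sub_eq_zero, M.sub_lam_b (n + 1), ← hyz, b'_b']
  · intro x hx
    obtain ⟨hl, hb⟩ := (M.mem_cyclicCocycles n x).1 hx
    obtain ⟨y, rfl⟩ := M.exists_norm_eq n x hl
    obtain ⟨z, hz⟩ := M.exists_sub_lam_eq (n + 1) (M.b' n y) (by rw [norm_b', hb])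
    exact ⟨_, (M.mem_periodicity n _ _).2 ⟨y, z, hz.symm, rfl, rfl⟩⟩
  · intro w hw
    obtain ⟨hl, hb⟩ := (M.mem_cyclicCocycles (n + 2) w).1 hw
    obtain ⟨z, rfl⟩ := c.exists_b_eq (n + 1) w hb
    obtain ⟨y, hy⟩ := c.exists_b'_eq n (z - M.lam (n + 1) z) (by
      rw [← sub_lam_b, hl, sub_self])
    exact ⟨_, (M.mem_periodicity n _ _).2 ⟨y, z, hy, rfl, rfl⟩⟩
  · rintro ⟨x, w⟩ h
    obtain ⟨y, z, hyz, rfl, rfl⟩ := (M.mem_periodicity n x w).1 h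
    change M.norm n y ∈ _ ↔ M.b (n + 1) z ∈ _
    rw [mem_cyclicCoboundaries_succ]
    constructor
    · intro hx
      -- in all degrees, `y` differs from some `y'` with `b' y' = 0` by an element of `ker N`
      obtain ⟨y', hy', hn⟩ : ∃ y', M.b' n y' = 0 ∧ M.norm n (y - y') = 0 := by
        cases n with
        | zero =>
          exact ⟨0, map_zero _, by simpa [cyclicCoboundaries] using hx⟩
        | succ m =>
          obtain ⟨u, hu, hbu⟩ := (M.mem_cyclicCoboundaries_succ m _).1 hx
          obtain ⟨u', rfl⟩ := M.exists_norm_eq m u hu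
          exact ⟨M.b' m u', M.b'_b' m u', by rw [map_sub, norm_b', hbu, sub_self]⟩
      obtain ⟨v, hv⟩ := M.exists_sub_lam_eq n _ hn
      refine ⟨z - M.b n v, ?_, by rw [map_sub, b_b, sub_zero]⟩
      have h1 := M.sub_lam_b n v
      rw [hv, map_sub, hy', sub_zero, hyz] at h1
      rw [map_sub, sub_eq_sub_iff_sub_eq_sub, ← sub_eq_zero]
      rw [← sub_eq_zero] at h1
      rw [← h1]
      abel
    · rintro ⟨a, ha, hab⟩
      obtain ⟨v, hv⟩ := c.exists_b_eq n (z - a) (by rw [map_sub, hab, sub_self])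
      have h1 : M.b' n (y - (v - M.lam n v)) = 0 := by
        rw [map_sub, ← sub_lam_b, hv, map_sub, ha, hyz]
        abel
      have h2 : M.norm n (y - (v - M.lam n v)) = M.norm n y := by
        rw [map_sub, map_sub, norm_lam, sub_self, sub_zero]
      rw [← h2]
      cases n with
      | zero => rw [c.eq_zero_of_b'_zero _ h1, map_zero]; exact Submodule.zero_mem _
      | succ m =>
        obtain ⟨u, hu⟩ := c.exists_b'_eq m _ h1
        rw [← hu, norm_b', mem_cyclicCoboundaries_succ]
        exact ⟨_, M.lam_norm m u, rfl⟩

theorem nonempty_HC_zero_equiv : Nonempty (M.HC 0 ≃ₗ[k] LinearMap.ker (M.b 0)) := by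
  have h : M.cyclicCocycles 0 = LinearMap.ker (M.b 0) := by
    ext x
    rw [mem_cyclicCocycles, LinearMap.mem_ker, M.lam_zero]
    simp
  have h' : (M.cyclicCoboundaries 0).comap (M.cyclicCocycles 0).subtype = ⊥ :=
    Submodule.ker_subtype _
  exact ⟨Submodule.quotEquivOfEqBot _ h' ≪≫ₗ LinearEquiv.ofEq _ _ h⟩

theorem Contraction.subsingleton_HC_one (c : M.Contraction) : Subsingleton (M.HC 1) := by
  refine Submodule.Quotient.subsingleton_iff.2 (eq_top_iff.2 fun x _ => ?_)
  obtain ⟨y, hy⟩ := c.exists_b_eq 0 x.1 ((M.mem_cyclicCocycles 1 _).1 x.2).2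
  exact (M.mem_cyclicCoboundaries_succ 0 _).2 ⟨y, M.lam_zero y, hy⟩

theorem Contraction.HC_eq [CharZero k] (c : M.Contraction) (i : ℕ) :
    Subsingleton (M.HC (2 * i + 1)) ∧ Nonempty (M.HC (2 * i) ≃ₗ[k] LinearMap.ker (M.b 0)) := by
  induction i with
  | zero => exact ⟨c.subsingleton_HC_one, nonempty_HC_zero_equiv⟩
  | succ i ih =>
    obtain ⟨h, ⟨e⟩⟩ := ih
    obtain ⟨e₁⟩ := c.periodic (2 * i + 1)
    obtain ⟨e₂⟩ := c.periodic (2 * i)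
    exact ⟨e₁.symm.toEquiv.subsingleton, ⟨e₂.symm ≪≫ₗ e⟩⟩

end PreCocyclic

/-! ### Diagonal actions -/

/-- Every element of `H ⊗_R M` is a finite sum of elements `h ⊗ m`. -/
theorem SourceTarget.exists_sum_tmul {k : Type v} {R H : Type u} [Field k] [Ring R] [Algebra k R]
    [Ring H] [Algebra k H] (S : SourceTarget k R H) (M : LMod k R) (y : S.Tens M) :
    ∃ s : Finset (H × M.carrier), y = ∑ i ∈ s, S.tmul M i.1 i.2 := by
  obtain ⟨t, rfl⟩ := S.proj_surjective M y
  obtain ⟨s, rfl⟩ := TensorProduct.exists_finset t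
  exact ⟨s, map_sum _ _ _⟩

namespace Bialgebroid

variable {k : Type v} {R H : Type u} [Field k] [Ring R] [Algebra k R] [Ring H] [Algebra k H]
variable {B : Bialgebroid k R H}

/-- Multiplicativity of an action of `H` by linear maps. -/
structure HAct.IsAction {M : LMod k R} (A : B.HAct M) : Prop where
  one_act : ∀ m, A.toLin 1 m = m
  mul_act : ∀ a b m, A.toLin (a * b) m = A.toLin a (A.toLin b m)

theorem HAct.tens_toLin_tmul {M : LMod k R} (A : B.HAct M) (h g : H) (m : M.carrier) :
    A.tens.toLin h (B.tmul M g m) = A.pair g m (B.comul.toLin h) := rfl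

/-- The diagonal action is multiplicative because `Δ` is. -/
theorem HAct.IsAction.tens {M : LMod k R} {A : B.HAct M} (hA : A.IsAction) :
    A.tens.IsAction where
  one_act := fun m => by
    refine LinearMap.congr_fun (f := A.tens.toLin 1) (g := LinearMap.id) ?_ m
    refine B.hom_ext fun g m => ?_
    rw [HAct.tens_toLin_tmul, B.comul_one, HAct.pair_tmul, one_mul, hA.one_act, LinearMap.id_apply]
  mul_act := fun a b x => by
    refine LinearMap.congr_fun (f := A.tens.toLin (a * b))
      (g := A.tens.toLin a ∘ₗ A.tens.toLin b) ?_ x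
    refine B.hom_ext fun g m => ?_
    obtain ⟨s, hs⟩ := B.proj_surjective B.self (B.comul.toLin a)
    obtain ⟨t, ht⟩ := B.proj_surjective B.self (B.comul.toLin b)
    rw [LinearMap.comp_apply, HAct.tens_toLin_tmul, HAct.tens_toLin_tmul,
      B.comul_mul a b s t hs ht, ← ht]
    refine LinearMap.congr_fun
      (f := A.pair g m ∘ₗ B.proj B.self ∘ₗ LinearMap.mulLeft k s)
      (g := A.tens.toLin a ∘ₗ A.pair g m ∘ₗ B.proj B.self) ?_ t
    refine TensorProduct.ext' fun c d => ?_
    change A.pair g m (B.proj B.self (s * c ⊗ₜ d)) = A.pair (c * g) (A.toLin d m) (B.comul.toLin a)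
    rw [← hs]
    refine LinearMap.congr_fun
      (f := A.pair g m ∘ₗ B.proj B.self ∘ₗ LinearMap.mulRight k (c ⊗ₜ d))
      (g := A.pair (c * g) (A.toLin d m) ∘ₗ B.proj B.self) ?_ s
    refine TensorProduct.ext' fun p q => ?_
    rw [LinearMap.comp_apply, LinearMap.comp_apply, LinearMap.mulRight_apply,
      Algebra.TensorProduct.tmul_mul_tmul]
    change B.tmul M (p * c * g) (A.toLin (q * d) m) = B.tmul M (p * (c * g)) (A.toLin q _)
    rw [mul_assoc, hA.mul_act]

variable (B) in
theorem diag_isAction : ∀ n : ℕ, (B.diag n).IsAction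
  | 0 => ⟨fun m => one_mul m, fun a b m => mul_assoc a b m⟩
  | n + 1 => (diag_isAction n).tens

/-- `a ⊗ b ↦ a g ⊗ b ▷ m` as a homomorphism of left `R`-modules. -/
def HAct.pairHom {M : LMod k R} (A : B.HAct M) (g : H) (m : M.carrier) :
    (B.tens B.self).Hom (B.tens M) where
  toLin := A.pair g m
  map_act := fun r x => by
    refine LinearMap.congr_fun (f := A.pair g m ∘ₗ (B.tens B.self).act r)
      (g := (B.tens M).act r ∘ₗ A.pair g m) ?_ x
    exact B.hom_ext fun a b => by simp [mul_assoc]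

/-- `a ↦ a ▷ m` as a homomorphism of left `R`-modules. -/
def HAct.orbit {M : LMod k R} (A : B.HAct M) (m : M.carrier) : B.self.Hom M where
  toLin := A.toLin.flip m
  map_act := fun r h => A.alpha_mul r h m

variable (B) in
/-- `g ⊗ m ↦ g h ⊗ f m` for a left `R`-linear map `f`. -/
def mulMap {M N : LMod k R} (h : H) (f : M.Hom N) : (B.tens M).Hom (B.tens N) where
  toLin := B.map (LinearMap.mulRight k h) (fun _ _ => by simp [mul_assoc]) f
  map_act := fun r x => by
    refine LinearMap.congr_fun
      (f := B.map (LinearMap.mulRight k h) (fun _ _ => by simp [mul_assoc]) f ∘ₗ (B.tens M).act r)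
      (g := (B.tens N).act r ∘ₗ B.map (LinearMap.mulRight k h)
        (fun _ _ => by simp [mul_assoc]) f) ?_ x
    exact B.hom_ext fun a b => congrArg (fun y => B.tmul N y (f.toLin b)) (mul_assoc _ _ _)

theorem idTens_tmul {M N : LMod k R} (f : M.Hom N) (g : H) (m : M.carrier) :
    (B.idTens f).toLin (B.tmul M g m) = B.tmul N g (f.toLin m) := rfl

theorem tensId_tmul (M : LMod k R) (h : H) (m : M.carrier) :
    (B.tensId B.comul B.comul_right M).toLin (B.tmul M h m) =
      (B.idTens (B.tmulRight M m)).toLin (B.comul.toLin h) := rfl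

theorem tmulRight_apply (M : LMod k R) (h : H) (m : M.carrier) :
    (B.tmulRight M m).toLin h = B.tmul M h m := rfl

/-- The action on `g ⊗ m` is the image of `Δ(h) · (g ⊗ 1)` under `a ⊗ b ↦ a ⊗ b ▷ m`. -/
theorem HAct.tens_toLin_eq {M : LMod k R} (A : B.HAct M) (h g : H) (m : M.carrier) :
    A.tens.toLin h (B.tmul M g m) =
      (B.idTens (A.orbit m)).toLin ((B.diag 0).pair g 1 (B.comul.toLin h)) := by
  rw [HAct.tens_toLin_tmul]
  refine LinearMap.congr_fun (f := A.pair g m)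
    (g := (B.idTens (A.orbit m)).toLin ∘ₗ (B.diag 0).pair g 1) ?_ _
  refine B.hom_ext fun a b => ?_
  change B.tmul M (a * g) (A.toLin b m) = B.tmul M (a * g) (A.toLin (b * 1) m)
  rw [mul_one]

/-- Multiplicativity of `Δ`, in terms of the diagonal action on `H ⊗_R H`. -/
theorem comul_mul_eq_diag (a g : H) :
    B.comul.toLin (a * g) = (B.diag 1).toLin a (B.comul.toLin g) := by
  obtain ⟨s, hs⟩ := B.proj_surjective B.self (B.comul.toLin a)
  obtain ⟨t, ht⟩ := B.proj_surjective B.self (B.comul.toLin g)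
  rw [B.comul_mul a g s t hs ht, ← ht]
  refine LinearMap.congr_fun (f := B.proj B.self ∘ₗ LinearMap.mulLeft k s)
    (g := (B.diag 1).toLin a ∘ₗ B.proj B.self) ?_ t
  refine TensorProduct.ext' fun c d => ?_
  change B.proj B.self (s * c ⊗ₜ d) = (B.diag 0).pair c d (B.comul.toLin a)
  rw [← hs]
  refine LinearMap.congr_fun (f := B.proj B.self ∘ₗ LinearMap.mulRight k (c ⊗ₜ d))
    (g := (B.diag 0).pair c d ∘ₗ B.proj B.self) ?_ s
  refine TensorProduct.ext' fun p q => ?_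
  rw [LinearMap.comp_apply, LinearMap.mulRight_apply, Algebra.TensorProduct.tmul_mul_tmul]
  rfl

/-- `Δ ⊗ id` is equivariant for the diagonal actions, by coassociativity. -/
theorem tensId_equivariant {M : LMod k R} (A : B.HAct M) (a : H) (x : B.Tens M) :
    (B.tensId B.comul B.comul_right M).toLin (A.tens.toLin a x) =
      A.tens.tens.toLin a ((B.tensId B.comul B.comul_right M).toLin x) := by
  refine LinearMap.congr_fun
    (f := (B.tensId B.comul B.comul_right M).toLin ∘ₗ A.tens.toLin a)
    (g := A.tens.tens.toLin a ∘ₗ (B.tensId B.comul B.comul_right M).toLin) ?_ x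
  refine B.hom_ext fun g m => ?_
  obtain ⟨S, hS⟩ := B.exists_sum_tmul B.self (B.comul.toLin a)
  have key : ∑ i ∈ S, (B.idTens (B.tmulRight M (A.toLin i.2 m))).toLin ∘ₗ (B.diag 1).toLin i.1 =
      A.tens.tens.toLin a ∘ₗ (B.idTens (B.tmulRight M m)).toLin := by
    refine B.hom_ext fun g₁ g₂ => ?_
    -- both sides are images of those of the coassociativity law under
    -- `x ⊗ y ⊗ z ↦ x g₁ ⊗ y g₂ ⊗ z ▷ m`
    have h := congrArg (B.mulMap g₁ (A.pairHom g₂ m)).toLin (B.coassoc a)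
    rw [hS, map_sum, map_sum, map_sum, map_sum] at h
    rw [LinearMap.sum_apply, LinearMap.comp_apply, idTens_tmul, tmulRight_apply,
      HAct.tens_toLin_tmul, hS, map_sum]
    refine Eq.trans (Finset.sum_congr rfl fun i _ => ?_) h
    refine LinearMap.congr_fun
      (f := (B.idTens (B.tmulRight M (A.toLin i.2 m))).toLin ∘ₗ (B.diag 0).pair g₁ g₂)
      (g := (B.mulMap g₁ (A.pairHom g₂ m)).toLin ∘ₗ (B.idTens (B.tmulRight B.self i.2)).toLin) ?_
      (B.comul.toLin i.1)
    exact B.hom_ext fun c d => rfl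
  have h := LinearMap.congr_fun key (B.comul.toLin g)
  rw [LinearMap.comp_apply, LinearMap.comp_apply, HAct.tens_toLin_tmul, tensId_tmul, hS,
    map_sum, map_sum]
  rw [LinearMap.sum_apply] at h
  refine Eq.trans (Finset.sum_congr rfl fun i _ => ?_) h
  rw [HAct.pair_tmul, tensId_tmul, comul_mul_eq_diag, LinearMap.comp_apply]

/-- The inner cofaces commute with the diagonal actions. The bound `i ≤ n` excludes the last coface,
which appends `1` and does not. -/
theorem innerCoface_equivariant (a : H) : ∀ (n i : ℕ) (_ : i ≤ n) (x : (B.pow n).carrier),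
    (B.innerCoface n i).toLin ((B.diag n).toLin a x) =
      (B.diag (n + 1)).toLin a ((B.innerCoface n i).toLin x)
  | 0, 0, _, x => comul_mul_eq_diag a x
  | n + 1, 0, _, x => tensId_equivariant (B.diag n) a x
  | n + 1, i + 1, hi, x => by
    refine LinearMap.congr_fun
      (f := (B.idTens (B.innerCoface n i)).toLin ∘ₗ (B.diag n).tens.toLin a)
      (g := (B.diag (n + 1)).tens.toLin a ∘ₗ (B.idTens (B.innerCoface n i)).toLin) ?_ x
    refine B.hom_ext fun g m => ?_
    obtain ⟨S, hS⟩ := B.exists_sum_tmul B.self (B.comul.toLin a)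
    change (B.idTens (B.innerCoface n i)).toLin ((B.diag n).pair g m (B.comul.toLin a)) =
      (B.diag (n + 1)).pair g ((B.innerCoface n i).toLin m) (B.comul.toLin a)
    rw [hS, map_sum, map_sum, map_sum]
    exact Finset.sum_congr rfl fun j _ => congrArg (B.tmul (B.pow (n + 1)) (j.1 * g))
      (innerCoface_equivariant j.2 n i (by omega) m)

/-! ### Appending a tensor factor -/

variable (B) in
/-- The map `h₁ ⊗ ⋯ ⊗ hₙ₊₁ ↦ h₁ ⊗ ⋯ ⊗ hₙ₊₁ ⊗ h`. -/
def append (h : H) : ∀ n : ℕ, (B.pow n).Hom (B.pow (n + 1))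
  | 0 => B.tmulRight B.self h
  | n + 1 => B.idTens (append h n)

theorem append_succ_tmul (h g : H) (n : ℕ) (m : (B.pow n).carrier) :
    (B.append h (n + 1)).toLin (B.tmul (B.pow n) g m) =
      B.tmul (B.pow (n + 1)) g ((B.append h n).toLin m) := rfl

theorem appendOne_eq_append : ∀ n : ℕ, B.appendOne n = B.append 1 n
  | 0 => rfl
  | n + 1 => congrArg B.idTens (appendOne_eq_append n)

theorem append_add (h h' : H) : ∀ n : ℕ,
    (B.append (h + h') n).toLin = (B.append h n).toLin + (B.append h' n).toLin
  | 0 => LinearMap.ext fun x => B.tmul_add B.self x h h'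
  | n + 1 => B.hom_ext fun g m => by
    rw [LinearMap.add_apply, append_succ_tmul, append_add h h' n, LinearMap.add_apply,
      B.tmul_add (B.pow (n + 1))]
    rfl

theorem append_smul (c : k) (h : H) : ∀ n : ℕ,
    (B.append (c • h) n).toLin = c • (B.append h n).toLin
  | 0 => LinearMap.ext fun x => B.tmul_smul B.self c x h
  | n + 1 => B.hom_ext fun g m => by
    rw [LinearMap.smul_apply, append_succ_tmul, append_smul c h n, LinearMap.smul_apply,
      B.tmul_smul (B.pow (n + 1))]
    rfl

theorem comul_beta (r : R) : B.comul.toLin (B.β r) = B.tmul B.self 1 (B.β r) := by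
  have h := B.comul_right r 1
  rw [mul_one, B.comul_one, idTens_tmul] at h
  rw [h]
  exact congrArg (B.tmul B.self 1) (mul_one _)

/-- The balancing relation at the last tensor sign. -/
theorem append_diag_beta (r : R) (h : H) : ∀ (n : ℕ) (x : (B.pow n).carrier),
    (B.append h n).toLin ((B.diag n).toLin (B.β r) x) = (B.append (B.α r * h) n).toLin x
  | 0, x => B.tmul_balanced B.self r x h
  | n + 1, x => by
    refine LinearMap.congr_fun
      (f := (B.append h (n + 1)).toLin ∘ₗ (B.diag n).tens.toLin (B.β r))
      (g := (B.append (B.α r * h) (n + 1)).toLin) ?_ x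
    refine B.hom_ext fun g m => ?_
    rw [LinearMap.comp_apply, HAct.tens_toLin_tmul, comul_beta, HAct.pair_tmul, one_mul,
      append_succ_tmul, append_diag_beta r h n m, append_succ_tmul]

variable (B) in
/-- The linear map underlying `actAppend`. -/
def actAppendLin (n : ℕ) (y : (B.pow n).carrier) :
    B.Tens B.self →ₗ[k] (B.pow (n + 1)).carrier :=
  B.lift B.self
    (LinearMap.mk₂ k (fun a b => (B.append b n).toLin ((B.diag n).toLin a y))
      (fun a a' b => by simp) (fun c a b => by simp)
      (fun a b b' => by rw [append_add, LinearMap.add_apply])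
      (fun c a b => by rw [append_smul, LinearMap.smul_apply]))
    (fun r h m => by
      rw [LinearMap.mk₂_apply, LinearMap.mk₂_apply, (B.diag_isAction n).mul_act,
        append_diag_beta]
      rfl)

variable (B) in
/-- For `y` in the `(n+1)`-fold tensor power of `H`, the map `a ⊗ b ↦ (a ▷ y) ⊗ b`. -/
def actAppend (n : ℕ) (y : (B.pow n).carrier) : (B.tens B.self).Hom (B.pow (n + 1)) where
  toLin := B.actAppendLin n y
  map_act := fun r x => by
    refine LinearMap.congr_fun (f := B.actAppendLin n y ∘ₗ (B.tens B.self).act r)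
      (g := (B.pow (n + 1)).act r ∘ₗ B.actAppendLin n y) ?_ x
    refine B.hom_ext fun a b => ?_
    change (B.append b n).toLin ((B.diag n).toLin (B.α r * a) y) =
      (B.pow (n + 1)).act r ((B.append b n).toLin ((B.diag n).toLin a y))
    rw [(B.diag n).alpha_mul, (B.append b n).map_act]

theorem actAppend_tmul (n : ℕ) (y : (B.pow n).carrier) (a b : H) :
    (B.actAppend n y).toLin (B.tmul B.self a b) =
      (B.append b n).toLin ((B.diag n).toLin a y) := rfl

theorem actAppend_add (n : ℕ) (y y' : (B.pow n).carrier) :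
    (B.actAppend n (y + y')).toLin = (B.actAppend n y).toLin + (B.actAppend n y').toLin :=
  B.hom_ext fun a b => by
    rw [LinearMap.add_apply, actAppend_tmul, map_add, map_add]
    rfl

theorem actAppend_smul (n : ℕ) (c : k) (y : (B.pow n).carrier) :
    (B.actAppend n (c • y)).toLin = c • (B.actAppend n y).toLin :=
  B.hom_ext fun a b => by
    rw [LinearMap.smul_apply, actAppend_tmul, map_smul, map_smul]
    rfl

variable (B) in
/-- `actAppend` as a linear map in `y`, evaluated at a fixed element. -/
def actAppendAt (n : ℕ) (w : B.Tens B.self) :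
    (B.pow n).carrier →ₗ[k] (B.pow (n + 1)).carrier where
  toFun y := (B.actAppend n y).toLin w
  map_add' y y' := by rw [actAppend_add, LinearMap.add_apply]
  map_smul' c y := by rw [actAppend_smul, LinearMap.smul_apply, RingHom.id_apply]

/-- `v ▷ (y ⊗ 1) = (v⁽¹⁾ ▷ y) ⊗ v⁽²⁾`: the diagonal action may be computed with the tensor power
bracketed to the left, by coassociativity. -/
theorem diag_append_one : ∀ (n : ℕ) (v : H) (y : (B.pow n).carrier),
    (B.diag (n + 1)).toLin v ((B.append 1 n).toLin y) = (B.actAppend n y).toLin (B.comul.toLin v)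
  | 0, v, y => by
    refine LinearMap.congr_fun (f := (B.diag 0).pair y 1) (g := (B.actAppend 0 y).toLin) ?_ _
    refine B.hom_ext fun a b => ?_
    change B.tmul B.self (a * y) (b * 1) = B.tmul B.self (a * y) b
    rw [mul_one]
  | n + 1, v, y => by
    refine LinearMap.congr_fun
      (f := (B.diag (n + 2)).toLin v ∘ₗ (B.append 1 (n + 1)).toLin)
      (g := B.actAppendAt (n + 1) (B.comul.toLin v)) ?_ y
    refine B.hom_ext fun g m => ?_
    obtain ⟨S, hS⟩ := B.exists_sum_tmul B.self (B.comul.toLin v)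
    have h := congrArg (B.mulMap g (B.actAppend n m)).toLin (B.coassoc v)
    rw [hS, map_sum, map_sum, map_sum, map_sum] at h
    rw [LinearMap.comp_apply, append_succ_tmul]
    change (B.diag (n + 1)).pair g ((B.append 1 n).toLin m) (B.comul.toLin v) =
      (B.actAppend (n + 1) (B.tmul (B.pow n) g m)).toLin (B.comul.toLin v)
    rw [hS, map_sum, map_sum]
    refine Eq.trans (Finset.sum_congr rfl fun i _ => ?_)
      (h.symm.trans (Finset.sum_congr rfl fun i _ => ?_))
    · exact congrArg (B.tmul (B.pow (n + 1)) (i.1 * g)) (diag_append_one n i.2 m)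
    · rw [actAppend_tmul]
      refine LinearMap.congr_fun
        (f := (B.mulMap g (B.actAppend n m)).toLin ∘ₗ (B.idTens (B.tmulRight B.self i.2)).toLin)
        (g := (B.append i.2 (n + 1)).toLin ∘ₗ (B.diag n).pair g m) ?_ (B.comul.toLin i.1)
      exact B.hom_ext fun c d => rfl

/-- Cofaces in the first factors commute with appending a factor. -/
theorem innerCoface_append (h : H) : ∀ (n i : ℕ) (_ : i ≤ n) (x : (B.pow n).carrier),
    (B.innerCoface (n + 1) i).toLin ((B.append h n).toLin x) =
      (B.append h (n + 1)).toLin ((B.innerCoface n i).toLin x)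
  | 0, 0, _, x => rfl
  | n + 1, 0, _, x => by
    refine LinearMap.congr_fun
      (f := (B.tensId B.comul B.comul_right (B.pow (n + 1))).toLin ∘ₗ (B.append h (n + 1)).toLin)
      (g := (B.append h (n + 2)).toLin ∘ₗ (B.tensId B.comul B.comul_right (B.pow n)).toLin) ?_ x
    refine B.hom_ext fun g m => ?_
    rw [LinearMap.comp_apply, LinearMap.comp_apply, append_succ_tmul, tensId_tmul, tensId_tmul]
    refine LinearMap.congr_fun
      (f := (B.idTens (B.tmulRight (B.pow (n + 1)) ((B.append h n).toLin m))).toLin)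
      (g := (B.append h (n + 2)).toLin ∘ₗ (B.idTens (B.tmulRight (B.pow n) m)).toLin) ?_ _
    exact B.hom_ext fun c d => rfl
  | n + 1, i + 1, hi, x => by
    refine LinearMap.congr_fun
      (f := (B.innerCoface (n + 2) (i + 1)).toLin ∘ₗ (B.append h (n + 1)).toLin)
      (g := (B.append h (n + 2)).toLin ∘ₗ (B.innerCoface (n + 1) (i + 1)).toLin) ?_ x
    refine B.hom_ext fun g m => ?_
    exact congrArg (B.tmul (B.pow (n + 2)) g) (innerCoface_append h n i (by omega) m)

theorem innerCoface_last : ∀ n : ℕ, B.innerCoface n (n + 1) = B.append 1 n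
  | 0 => rfl
  | n + 1 => congrArg B.idTens (innerCoface_last n)

/-- Appending `1` and then applying `Δ` to it appends `1` twice. -/
theorem innerCoface_append_one : ∀ (n : ℕ) (x : (B.pow n).carrier),
    (B.innerCoface (n + 1) (n + 1)).toLin ((B.append 1 n).toLin x) =
      (B.append 1 (n + 1)).toLin ((B.append 1 n).toLin x)
  | 0, x => congrArg (B.tmul (B.pow 1) x) B.comul_one
  | n + 1, x => by
    refine LinearMap.congr_fun
      (f := (B.innerCoface (n + 2) (n + 2)).toLin ∘ₗ (B.append 1 (n + 1)).toLin)
      (g := (B.append 1 (n + 2)).toLin ∘ₗ (B.append 1 (n + 1)).toLin) ?_ x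
    refine B.hom_ext fun g m => ?_
    exact congrArg (B.tmul (B.pow (n + 2)) g) (innerCoface_append_one n m)

end Bialgebroid

variable {k : Type v} {R H : Type u} [Field k] [Ring R] [Algebra k R] [Ring H] [Algebra k H]

/-! ### Pure tensors -/

namespace SourceTarget

variable (S : SourceTarget k R H)

/-- The tensor `f 0 ⊗ f 1 ⊗ ⋯ ⊗ f n`. The later values of `f` are not used; allowing them makes
it possible to rotate the factors by shifting a periodic sequence. -/
def pureTensor : ∀ n : ℕ, (ℕ → H) → (S.pow n).carrier
  | 0, f => f 0
  | n + 1, f => S.tmul (S.pow n) (f 0) (pureTensor n fun i => f (i + 1))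

theorem pureTensor_congr : ∀ (n : ℕ) (f g : ℕ → H) (_ : ∀ i ≤ n, f i = g i),
    S.pureTensor n f = S.pureTensor n g
  | 0, _, _, h => h 0 le_rfl
  | n + 1, f, g, h => by
    rw [pureTensor, pureTensor, h 0 (Nat.zero_le _),
      pureTensor_congr n _ _ fun i hi => h (i + 1) (Nat.succ_le_succ hi)]

theorem pureTensor_ext {P : Type u} [AddCommGroup P] [Module k P] :
    ∀ (n : ℕ) (φ ψ : (S.pow n).carrier →ₗ[k] P)
      (_ : ∀ f : ℕ → H, φ (S.pureTensor n f) = ψ (S.pureTensor n f)), φ = ψ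
  | 0, _, _, h => LinearMap.ext fun x => h fun _ => x
  | n + 1, φ, ψ, h => S.hom_ext fun x m => by
    refine LinearMap.congr_fun (f := φ ∘ₗ S.tmulBilin (S.pow n) x)
      (g := ψ ∘ₗ S.tmulBilin (S.pow n) x) (pureTensor_ext n _ _ fun f => ?_) m
    exact h fun i => Nat.casesOn i x f

end SourceTarget

namespace Bialgebroid

variable (B : Bialgebroid k R H)

theorem append_pureTensor : ∀ (n : ℕ) (f : ℕ → H),
    (B.append (f (n + 1)) n).toLin (B.pureTensor n f) = B.pureTensor (n + 1) f
  | 0, _ => rfl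
  | n + 1, f => congrArg (B.tmul (B.pow (n + 1)) (f 0)) (append_pureTensor n fun i => f (i + 1))

end Bialgebroid

/-! ### The cyclic operator -/

namespace ParaHopfAlgebroid

variable (P : ParaHopfAlgebroid k R H)

theorem cyclicPow_succ_tmul (n : ℕ) (h : H) (m : (P.pow n).carrier) :
    P.cyclicPow (n + 1) (P.tmul (P.pow n) h m) =
      (P.diag (n + 1)).toLin (P.T h) ((P.append 1 n).toLin m) := by
  rw [← P.appendOne_eq_append]
  rfl

theorem T_alpha (r : R) : P.T (P.α r) = P.β r := by rw [← P.T_beta, P.T_T]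

/-- The cyclic operator on `u ▷ (g ⊗ y)`. For `g = 1` the identity reads
`T(u⁽¹⁾) ▷ ((u⁽²⁾ ▷ y) ⊗ 1) = y ⊗ T(u)`, which extends the defining identity of a para-Hopf
algebroid from `y = 1` to all tensors `y`. -/
theorem cyclicPow_succ_act (n : ℕ) (u g : H) (y : (P.pow n).carrier) :
    P.cyclicPow (n + 1) ((P.diag n).pair g y (P.comul.toLin u)) =
      (P.diag (n + 1)).toLin (P.T g) ((P.append (P.T u) n).toLin y) := by
  have h1 : P.cyclicPow (n + 1) ∘ₗ (P.diag n).pair g y =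
      (P.diag (n + 1)).toLin (P.T g) ∘ₗ (P.actAppend n y).toLin ∘ₗ P.cyclicPow 1 := by
    -- since `T(a g) = T(g) T(a)`, the operator `T(g) ▷` splits off; what remains on the left is
    -- `T(a) ▷ ((b ▷ y) ⊗ 1) = (T(a)⁽¹⁾ b ▷ y) ⊗ T(a)⁽²⁾`
    refine P.hom_ext fun a b => ?_
    rw [LinearMap.comp_apply, Bialgebroid.HAct.pair_tmul, cyclicPow_succ_tmul, P.T_mul,
      (P.diag_isAction (n + 1)).mul_act, Bialgebroid.diag_append_one]
    refine congrArg ((P.diag (n + 1)).toLin (P.T g)) ?_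
    refine LinearMap.congr_fun (f := (P.actAppend n ((P.diag n).toLin b y)).toLin)
      (g := (P.actAppend n y).toLin ∘ₗ (P.diag 0).pair b 1) ?_ (P.comul.toLin (P.T a))
    refine P.hom_ext fun c d => ?_
    change (P.append d n).toLin ((P.diag n).toLin c ((P.diag n).toLin b y)) =
      (P.append (d * 1) n).toLin ((P.diag n).toLin (c * b) y)
    rw [(P.diag_isAction n).mul_act, mul_one]
  refine (LinearMap.congr_fun h1 (P.comul.toLin u)).trans ?_
  rw [LinearMap.comp_apply, LinearMap.comp_apply, P.cyclic_comul, Bialgebroid.actAppend_tmul,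
    (P.diag_isAction n).one_act]

/-- On tensors `T(g₀) ▷ (g₁ ⊗ ⋯ ⊗ gₙ)` the cyclic operator rotates `g₀, …, gₙ`. -/
theorem cyclicPow_act_pureTensor (n : ℕ) (f : ℕ → H) (hf : f (n + 2) = f 0) :
    P.cyclicPow n ((P.diag n).toLin (P.T (f 0)) (P.pureTensor n fun i => f (i + 1))) =
      (P.diag n).toLin (P.T (f 1)) (P.pureTensor n fun i => f (i + 2)) := by
  cases n with
  | zero =>
    change P.T (P.T (f 0) * f 1) = P.T (f 1) * f 2
    rw [P.T_mul, P.T_T, hf]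
  | succ n =>
    refine (P.cyclicPow_succ_act n (P.T (f 0)) (f 1)
      (P.pureTensor n fun i => f (i + 2))).trans ?_
    rw [P.T_T, ← hf]
    exact congrArg _ (P.append_pureTensor n fun i => f (i + 2))

/-- The cyclic operator on the `(n+1)`-fold tensor power has order dividing `n + 2`: written as
`T(1) ▷ (g₁ ⊗ ⋯ ⊗ gₙ₊₁)`, a pure tensor has `n + 2` entries to rotate. -/
theorem cyclicPow_pow (n : ℕ) : P.cyclicPow n ^ (n + 2) = 1 := by
  refine P.pureTensor_ext n _ _ fun g => ?_
  -- the sequence `1, g 0, …, g n`, continued periodically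
  let f : ℕ → H := fun i => Nat.casesOn (i % (n + 2)) 1 g
  have hf : ∀ i, f (i + (n + 2)) = f i := fun i => by simp [f]
  have hpow : ∀ j, (P.cyclicPow n ^ j)
      ((P.diag n).toLin (P.T (f 0)) (P.pureTensor n fun i => f (i + 1))) =
        (P.diag n).toLin (P.T (f j)) (P.pureTensor n fun i => f (i + 1 + j)) := fun j => by
    induction j with
    | zero => rfl
    | succ j ih =>
      rw [pow_succ', Module.End.mul_apply, ih]
      have h := P.cyclicPow_act_pureTensor n (fun i => f (i + j)) (by
        rw [zero_add, add_comm, hf])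
      simp only [zero_add] at h
      rw [h, add_comm 1 j]
      exact congrArg _ (P.pureTensor_congr n _ _ fun i _ => congrArg f (by omega))
  have h0 : P.T (f 0) = 1 := P.T_one
  have hg : (P.pureTensor n fun i => f (i + 1)) = P.pureTensor n g :=
    P.pureTensor_congr n _ _ fun i hi => by
      simp only [f]
      rw [Nat.mod_eq_of_lt (by omega)]
  have h := hpow (n + 2)
  rw [(P.pureTensor_congr n (fun i => f (i + 1 + (n + 2))) (fun i => f (i + 1))
    fun i _ => hf _), ← zero_add (n + 2), hf, h0, (P.diag_isAction n).one_act, hg, zero_add] at h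
  exact h

theorem cyclicPow_one_tmul (n : ℕ) (x : (P.pow n).carrier) :
    P.cyclicPow (n + 1) (P.tmul (P.pow n) 1 x) = (P.append 1 n).toLin x := by
  rw [cyclicPow_succ_tmul, P.T_one, (P.diag_isAction (n + 1)).one_act]

theorem cyclicPow_innerCoface_zero : ∀ (n : ℕ) (x : (P.pow n).carrier),
    P.cyclicPow (n + 1) ((P.innerCoface n 0).toLin x) = P.tmul (P.pow n) 1 (P.cyclicPow n x)
  | 0, x => P.cyclic_comul x
  | n + 1, x => by
    refine LinearMap.congr_fun
      (f := P.cyclicPow (n + 2) ∘ₗ (P.tensId P.comul P.comul_right (P.pow n)).toLin)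
      (g := P.tmulBilin (P.pow (n + 1)) 1 ∘ₗ P.cyclicPow (n + 1)) ?_ x
    refine P.hom_ext fun h m => ?_
    -- the defining identity of a para-Hopf algebroid, with `H` acting on `m ⊗ 1`
    have h1 : P.cyclicPow (n + 2) ∘ₗ (P.idTens (P.tmulRight (P.pow n) m)).toLin =
        (P.idTens ((P.diag (n + 1)).orbit ((P.append 1 n).toLin m))).toLin ∘ₗ
          P.cyclicPow 1 := by
      refine P.hom_ext fun a b => ?_
      rw [LinearMap.comp_apply, LinearMap.comp_apply, Bialgebroid.idTens_tmul,
        Bialgebroid.tmulRight_apply, cyclicPow_succ_tmul, Bialgebroid.append_succ_tmul,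
        cyclicPow_succ_tmul]
      exact Bialgebroid.HAct.tens_toLin_eq (P.diag (n + 1)) (P.T a) b ((P.append 1 n).toLin m)
    refine (LinearMap.congr_fun h1 (P.comul.toLin h)).trans ?_
    rw [LinearMap.comp_apply, LinearMap.comp_apply, P.cyclic_comul, cyclicPow_succ_tmul]
    rfl

theorem cyclicPow_innerCoface_succ (n i : ℕ) (hi : i ≤ n) (x : (P.pow n).carrier) :
    P.cyclicPow (n + 1) ((P.innerCoface n (i + 1)).toLin x) =
      (P.innerCoface n i).toLin (P.cyclicPow n x) := by
  cases n with
  | zero =>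
    obtain rfl : i = 0 := by omega
    have h := P.comul_mul_eq_diag (P.T x) 1
    rw [mul_one, P.comul_one] at h
    exact h.symm
  | succ n =>
    refine LinearMap.congr_fun
      (f := P.cyclicPow (n + 2) ∘ₗ (P.innerCoface (n + 1) (i + 1)).toLin)
      (g := (P.innerCoface (n + 1) i).toLin ∘ₗ P.cyclicPow (n + 1)) ?_ x
    refine P.hom_ext fun h m => ?_
    refine (P.cyclicPow_succ_tmul (n + 1) h ((P.innerCoface n i).toLin m)).trans ?_
    rw [LinearMap.comp_apply, cyclicPow_succ_tmul, Bialgebroid.innerCoface_equivariant _ _ _ hi]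
    refine congrArg _ ?_
    rcases Nat.le_succ_iff.1 hi with h' | rfl
    · exact (Bialgebroid.innerCoface_append 1 n i h' m).symm
    · rw [Bialgebroid.innerCoface_last]
      exact (Bialgebroid.innerCoface_append_one n m).symm

/-! ### The cocyclic module and its contraction -/

/-- The cofaces, with `δ₀ = β` and `δ₁ = α` in degree `0`: for this choice, rather than the
opposite one, the cosimplicial identities `δⱼ δ₀ = δ₀ δⱼ₋₁` hold in degree `0`. The Hochschild
coboundary in degree `0` only changes its sign. -/
def cosimplicialCoface : ∀ n : ℕ, ℕ → ((P.cochain n).carrier →ₗ[k] (P.cochain (n + 1)).carrier)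
  | 0, 0 => P.β
  | 0, _ + 1 => P.α.toLinearMap
  | n + 1, i => P.coface (n + 1) i

/-- The cocyclic module of a para-Hopf algebroid. -/
def preCocyclic : PreCocyclic k fun n => (P.cochain n).carrier where
  δ := P.cosimplicialCoface
  τ := P.cyclic
  δ_succ_δ_zero
    | 0, 0, _, r => P.comul_beta r
    | 0, 1, _, r => by
      have h := P.tmul_balanced P.self r 1 1
      rw [mul_one] at h
      exact h.trans (congrArg (P.tmul P.self 1) (mul_one _))
    | n + 1, 0, _, x => by
      change (P.idTens (P.tmulRight (P.pow n) x)).toLin (P.comul.toLin 1) = _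
      rw [P.comul_one]
      rfl
    | n + 1, j + 1, _, x => rfl
  τ_δ_zero
    | 0, r => P.T_beta r
    | n + 1, x => by
      refine (P.cyclicPow_one_tmul n x).trans ?_
      rw [← Bialgebroid.innerCoface_last]
      rfl
  τ_δ_succ
    | 0, 0, _, r => P.T_alpha r
    | n + 1, 0, _, x => P.cyclicPow_innerCoface_zero n x
    | n + 1, i + 1, hi, x => P.cyclicPow_innerCoface_succ n i (by omega) x
  τ_pow
    | 0 => pow_one _
    | n + 1 => P.cyclicPow_pow n

/-- The map `H ⊗_R M → M`, `h ⊗ m ↦ t(h) · m`. -/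
def haarContract {B : Bialgebroid k R H} {t : H →ₗ[k] R} (ht : B.IsLeftHaarSystem t)
    (M : LMod k R) : B.Tens M →ₗ[k] M.carrier :=
  B.lift M (M.act.toLinearMap.comp t) fun r h m => by
    simp [ht.map_right]

/-- The contraction defined by a normal left Haar system: `t` in degree `1`, and
`h₀ ⊗ h₁ ⊗ ⋯ ⊗ hₙ ↦ α(t(h₀)) h₁ ⊗ ⋯ ⊗ hₙ` in higher degrees. -/
def haarContraction {t : H →ₗ[k] R} (ht : P.IsNormalLeftHaarSystem t) :
    P.preCocyclic.Contraction where
  s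
    | 0 => t
    | n + 1 => haarContract ht.toIsLeftHaarSystem (P.pow n)
  s_δ_zero
    | 0, r => by
      change t (P.β r) = r
      rw [← mul_one (P.β r), ht.map_right, ht.map_one, one_mul]
    | n + 1, x => by
      change (P.pow n).act (t 1) x = x
      rw [ht.map_one, map_one, Module.End.one_apply]
  s_δ_succ
    | 0, 0, _, h => by
      refine (ht.invariant h).trans ?_
      rw [mul_one, ht.alpha_eq_beta]
      rfl
    | 0, 1, _, h => mul_one (P.α (t h))
    | n + 1, 0, _, x => by
      refine LinearMap.congr_fun
        (f := haarContract ht.toIsLeftHaarSystem (P.pow (n + 1)) ∘ₗ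
          (P.tensId P.comul P.comul_right (P.pow n)).toLin)
        (g := P.tmulBilin (P.pow n) 1 ∘ₗ haarContract ht.toIsLeftHaarSystem (P.pow n)) ?_ x
      refine P.hom_ext fun h m => ?_
      have h1 : haarContract ht.toIsLeftHaarSystem (P.pow (n + 1)) ∘ₗ
          (P.idTens (P.tmulRight (P.pow n) m)).toLin =
            (P.tmulBilin (P.pow n)).flip m ∘ₗ P.contractLeft t ht.map_right :=
        P.hom_ext fun a b => rfl
      refine (LinearMap.congr_fun h1 (P.comul.toLin h)).trans ?_
      rw [LinearMap.comp_apply, ht.invariant, ht.alpha_eq_beta]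
      exact P.tmul_balanced (P.pow n) (t h) 1 m
    | n + 1, i + 1, _, x => by
      refine LinearMap.congr_fun
        (f := haarContract ht.toIsLeftHaarSystem (P.pow (n + 1)) ∘ₗ
          (P.innerCoface (n + 1) (i + 1)).toLin)
        (g := (P.innerCoface n i).toLin ∘ₗ haarContract ht.toIsLeftHaarSystem (P.pow n)) ?_ x
      exact P.hom_ext fun h m => ((P.innerCoface n i).map_act (t h) m).symm

theorem preCocyclic_b_zero : P.preCocyclic.b 0 = -P.b 0 := by
  have h1 : P.preCocyclic.b 0 = P.β + (-1 : k) • P.α.toLinearMap := by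
    rw [PreCocyclic.b, Finset.sum_range_succ, Finset.sum_range_one, pow_zero, one_smul, pow_one]
    rfl
  have h2 : P.b 0 = P.α.toLinearMap + (-1 : k) • P.β := by
    rw [Bialgebroid.b, Finset.sum_range_succ, Finset.sum_range_one, pow_zero, one_smul, pow_one]
    rfl
  rw [h1, h2]
  module

theorem ker_preCocyclic_b_zero :
    LinearMap.ker (P.preCocyclic.b 0) = LinearMap.ker (P.α.toLinearMap - P.β) := by
  have h : P.preCocyclic.b 0 = -(P.α.toLinearMap - P.β) := by
    rw [PreCocyclic.b, Finset.sum_range_succ, Finset.sum_range_one, pow_zero, one_smul, pow_one,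
      neg_sub, sub_eq_add_neg, neg_one_smul]
    rfl
  ext x
  rw [LinearMap.mem_ker, LinearMap.mem_ker, h, LinearMap.neg_apply, neg_eq_zero]

theorem preCocyclic_cyclicCocycles (n : ℕ) :
    P.preCocyclic.cyclicCocycles n = P.cyclicCocycles n := by
  cases n with
  | zero =>
    refine congrArg (P.cyclicCochains 0 ⊓ ·) ?_
    ext x
    rw [LinearMap.mem_ker, LinearMap.mem_ker, preCocyclic_b_zero, LinearMap.neg_apply, neg_eq_zero]
  | succ n => rfl

theorem preCocyclic_cyclicCoboundaries : ∀ n : ℕ,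
    P.preCocyclic.cyclicCoboundaries n = P.cyclicCoboundaries n
  | 0 => rfl
  | 1 => by
    change (P.cyclicCochains 0).map (P.preCocyclic.b 0) = (P.cyclicCochains 0).map (P.b 0)
    rw [preCocyclic_b_zero, Submodule.map_neg]
  | n + 2 => rfl

theorem nonempty_HC_equiv_preCocyclic (n : ℕ) : Nonempty (P.HC n ≃ₗ[k] P.preCocyclic.HC n) := by
  have h : ∀ {V : Type u} [AddCommGroup V] [Module k V] {Z B Z' B' : Submodule k V},
      Z' = Z → B' = B →
        Nonempty ((Z ⧸ B.comap Z.subtype) ≃ₗ[k] (Z' ⧸ B'.comap Z'.subtype)) := by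
    rintro V _ _ Z B _ _ rfl rfl
    exact ⟨LinearEquiv.refl _ _⟩
  exact h (P.preCocyclic_cyclicCocycles n) (P.preCocyclic_cyclicCoboundaries n)

end ParaHopfAlgebroid

end ParaHopf

theorem mainTheorem4 {k : Type v} [Field k] [CharZero k] {R H : Type u} [Ring R] [Algebra k R]
    [Ring H] [Algebra k H] (P : ParaHopf.ParaHopfAlgebroid k R H)
    (hP : ∃ t : H →ₗ[k] R, P.IsNormalLeftHaarSystem t) :
    (∀ i : ℕ, Subsingleton (P.HC (2 * i + 1))) ∧
      ∀ i : ℕ, Nonempty (P.HC (2 * i) ≃ₗ[k] LinearMap.ker (P.α.toLinearMap - P.β)) := by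
  obtain ⟨t, ht⟩ := hP
  refine ⟨fun i => ?_, fun i => ?_⟩
  · obtain ⟨e⟩ := P.nonempty_HC_equiv_preCocyclic (2 * i + 1)
    have := ((P.haarContraction ht).HC_eq i).1
    exact e.toEquiv.subsingleton
  · obtain ⟨e⟩ := P.nonempty_HC_equiv_preCocyclic (2 * i)
    obtain ⟨e'⟩ := ((P.haarContraction ht).HC_eq i).2
    exact ⟨e ≪≫ₗ e' ≪≫ₗ LinearEquiv.ofEq _ _ P.ker_preCocyclic_b_zero⟩
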